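/- Let $a>-1$, $\mathbb R^+=(0,\infty)$, $d\omega_a(x)=x^a\,dx$ on $\mathbb R^+$, $L^2_a=L^2(\mathbb R^+,d\omega_a)$ and $\mathcal B_a=\partial_{xx}+\frac ax\partial_x$. Let $\mathscr S^+$ be the set of all $\varphi\in C^\infty(\mathbb R^+;\mathbb C)$ with $$\sup_{x>0}\Big|x^m\big(\tfrac1x\partial_x\big)^k\varphi(x)\Big|<\infty\quad\text{for all } m,k\in\mathbb N_0,$$ and let $\mathbb S^+$ be the set of all $F\in C^\infty(\mathbb R^+\times\mathbb R;\mathbb C)$ with $$\sup_{k+\ell\le p}\ \sup_{x>0,\,t\in\mathbb R}(1+x^2+t^2)^{p/2}\Big|\big(\tfrac1x\partial_x\big)^k\partial_t^\ell F(x,t)\Big|<\infty\quad\text{for all } p\in\mathbb N_0.$$ Let $\varphi\in\mathscr S^+$ and $F\in\mathbb S^+$, and consider the Cauchy problem with Neumann condition $$\begin{cases}\partial_tu-i\mathcal B_au=F(x,t),& x\in\mathbb R^+,\ t\in\mathbb R,\\ \lim_{x\to0^+}x^a\partial_xu(x,t)=0,& t\in\mathbb R,\\ u(x,0)=\varphi(x),&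 x\in\mathbb R^+.\end{cases}\qquad(*)$$ A solution of $(*)$ is a function $u:\mathbb R^+\times\mathbb R\to\mathbb C$, of class $C^2$ in $x$ and differentiable in $t$, that satisfies the three equations pointwise and for which $t\mapsto u(\cdot,t)$ is a $C^1$ map from $\mathbb R$ to $L^2_a$. Then $(*)$ has a solution, it is unique, and for all $x>0$ and $t\ne0$ it is given by $$u(x,t)=\int_0^\infty S_a(x,y,t)\varphi(y)\,d\omega_a(y)+\int_0^t\int_0^\infty S_a(x,y,t-s)F(y,s)\,d\omega_a(y)\,ds,$$ where the integrals in $y$ (for $s\neq t$ in the second term) and then the integral in $s$ converge absolutely, and where for $x,y>0$ $$S_a(x,y,t)=\begin{cases}\dfrac{e^{i\frac{(a+1)\pi}4}}{(2|t|)^{\frac{a+1}2}}\Big(\dfrac{xy}{2|t|}\Big)^{\frac{1-a}2}J_{\frac{a-1}2}\Big(\dfrac{xy}{2|t|}\Big)e^{-i\frac{x^2+y^2}{4|t|}},& t<0,\\[2ex] \dfrac{e^{-i\frac{(a+1)\pi}4}}{(2|t|)^{\frac{a+1}2}}\Big(\dfrac{xy}{2|t|}\Big)^{\frac{1-a}2}J_{\frac{a-1}2}\Big(\dfrac{xy}{2|t|}\Big)e^{i\frac{x^2+y^2}{4|t|}},&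 t>0,\end{cases}$$ and $J_\nu(z)=\sum_{k=0}^\infty\frac{(-1)^k}{\Gamma(k+1)\Gamma(\nu+k+1)}\big(\frac z2\big)^{2k+\nu}$ is the Bessel function of the first kind of order $\nu$. -/

import Mathlib

open MeasureTheory Set Filter Topology
open scoped ContDiff

noncomputable section

namespace HalfLine

/-- The operator `(1/x) ∂ₓ`. -/
def radialDeriv (f : ℝ → ℂ) : ℝ → ℂ := fun x => ((1 / x : ℝ) : ℂ) * deriv f x

/-- The class `𝒮⁺` of smooth functions `φ` on `(0, ∞)` such that
`sup_{x > 0} |x ^ m ((1/x) ∂ₓ) ^ k φ(x)| < ∞` for all `m, k`. Only the values of `φ` on `(0, ∞)`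
matter. -/
structure IsSchwartzPlus (φ : ℝ → ℂ) : Prop where
  smooth : ContDiffOn ℝ ∞ φ (Ioi 0)
  bounded : ∀ m k : ℕ, ∃ C : ℝ, ∀ x : ℝ, 0 < x → ‖((x ^ m : ℝ) : ℂ) * (radialDeriv^[k] φ) x‖ ≤ C

/-- The class `𝕊⁺` of smooth functions `F` on `(0, ∞) × ℝ` such that for every `p`
`sup_{k + l ≤ p} sup_{x > 0, t} (1 + x² + t²) ^ (p/2) |((1/x) ∂ₓ) ^ k ∂ₜ ^ l F(x, t)| < ∞`.
Only the values of `F` on `(0, ∞) × ℝ` matter. -/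
structure IsSpaceTimeSchwartzPlus (F : ℝ → ℝ → ℂ) : Prop where
  smooth : ContDiffOn ℝ ∞ (fun q : ℝ × ℝ => F q.1 q.2) (Ioi 0 ×ˢ univ)
  bounded : ∀ p : ℕ, ∃ C : ℝ, ∀ k l : ℕ, k + l ≤ p → ∀ x : ℝ, 0 < x → ∀ t : ℝ,
    (1 + x ^ 2 + t ^ 2) ^ ((p : ℝ) / 2) *
      ‖(radialDeriv^[k] (fun z => iteratedDeriv l (fun s => F z s) t)) x‖ ≤ C

/-- The measure `dω_a(x) = x ^ a dx` on the half-line `(0, ∞)`. -/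
def omega (a : ℝ) : Measure ℝ :=
  (volume.restrict (Ioi 0)).withDensity (fun x => ENNReal.ofReal (x ^ a))

/-- The Bessel operator `ℬ_a f = f'' + (a/x) f'`. -/
def besselOp (a : ℝ) (f : ℝ → ℂ) (x : ℝ) : ℂ :=
  deriv (deriv f) x + ((a / x : ℝ) : ℂ) * deriv f x

/-- The Bessel function of the first kind of real order `ν`, at positive real argument `z`. -/
def besselJ (ν z : ℝ) : ℝ :=
  ∑' k : ℕ, (-1 : ℝ) ^ k / (Real.Gamma ((k : ℝ) + 1) * Real.Gamma (ν + (k : ℝ) + 1)) *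
    (z / 2) ^ (2 * (k : ℝ) + ν)

/-- The kernel `S_a(x, y, t)` for `x, y > 0` and `t ≠ 0`; its value at `t = 0` is set to `0`. -/
def kernelS (a x y t : ℝ) : ℂ :=
  if t < 0 then
    Complex.exp (Complex.I * (((a + 1) * Real.pi / 4 : ℝ) : ℂ)) /
        (((2 * |t|) ^ ((a + 1) / 2) : ℝ) : ℂ) *
      (((x * y / (2 * |t|)) ^ ((1 - a) / 2) * besselJ ((a - 1) / 2) (x * y / (2 * |t|)) : ℝ) : ℂ) *
      Complex.exp (-(Complex.I * (((x ^ 2 + y ^ 2) / (4 * |t|) : ℝ) : ℂ)))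
  else if 0 < t then
    Complex.exp (-(Complex.I * (((a + 1) * Real.pi / 4 : ℝ) : ℂ))) /
        (((2 * |t|) ^ ((a + 1) / 2) : ℝ) : ℂ) *
      (((x * y / (2 * |t|)) ^ ((1 - a) / 2) * besselJ ((a - 1) / 2) (x * y / (2 * |t|)) : ℝ) : ℂ) *
      Complex.exp (Complex.I * (((x ^ 2 + y ^ 2) / (4 * |t|) : ℝ) : ℂ))
  else 0

/-- `u` (of which only the values on `(0, ∞) × ℝ` matter) is a solution, in `L²_a = L²(ω_a)`, of
the Cauchy problem
`∂ₜ u - i ℬ_a u = F` on `(0, ∞) × ℝ`, `lim_{x → 0+} x ^ a ∂ₓ u(x, t) = 0`, `u(x, 0) = φ(x)`: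
it solves all three equations pointwise, and `t ↦ u(·, t)` is of class `C¹` from `ℝ` to `L²_a`. -/
structure IsSolution (a : ℝ) (φ : ℝ → ℂ) (F : ℝ → ℝ → ℂ) (u : ℝ → ℝ → ℂ) : Prop where
  contDiff_space : ∀ t : ℝ, ContDiffOn ℝ 2 (fun x => u x t) (Ioi 0)
  differentiable_time : ∀ x : ℝ, 0 < x → Differentiable ℝ (fun t => u x t)
  contDiff_L2 : ∃ U : ℝ → Lp ℂ 2 (omega a), ContDiff ℝ 1 U ∧
    ∀ t : ℝ, (U t : ℝ → ℂ) =ᵐ[omega a] fun x => u x t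
  equation : ∀ x : ℝ, 0 < x → ∀ t : ℝ,
    deriv (fun s => u x s) t - Complex.I * besselOp a (fun z => u z t) x = F x t
  neumann : ∀ t : ℝ,
    Tendsto (fun x : ℝ => ((x ^ a : ℝ) : ℂ) * deriv (fun z => u z t) x) (𝓝[>] 0) (𝓝 0)
  initial : ∀ x : ℝ, 0 < x → u x 0 = φ x

end HalfLine

end

/-!
The normalised Bessel functions `x ↦ (xξ) ^ ((1 - a) / 2) J_{(a - 1) / 2}(xξ)` are eigenfunctions
of `ℬ_a` with eigenvalue `-ξ²`, so the Hankel transform built from them turns the equation into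
`∂ₜ û + i ξ² û = F̂` for each `ξ`; the solution is the inverse Hankel transform of
`exp (-i t ξ²) φ̂` plus a Duhamel term. That the transform is an involution, and that
`exp (-i t ξ²)` corresponds to the kernel `S_a`, both come from the transform of a Gaussian
`exp (-z x²)` with complex `z`, continued to the imaginary axis.

Uniqueness is conservation of the `L²_a` norm of a difference `w` of two solutions. Here `w` is only
known to lie in `L²_a` together with `ℬ_a w`, and the boundary terms of `∫ ⟪w, i ℬ_a w⟫ dω_a` are
at most `|q| |w|` with `q = x ^ a w'`. Were `|q| |w|` bounded below near `0` or `∞`, then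
`|(log |q|)'| ≤ |q'| / |q|` would be bounded by a multiple of the integrable `|q'| |w|`, and `|q|`
would be comparable to a constant there. At `0` this contradicts the Neumann condition, and at `∞`
it makes `|w|` bounded below, contradicting `w ∈ L²_a`.
-/

noncomputable section

namespace HalfLine
/-! ### The measure `ω_a` -/

section Measure

variable {a : ℝ}

lemma omega_absolutelyContinuous (a : ℝ) : omega a ≪ volume.restrict (Ioi 0) :=
  withDensity_absolutelyContinuous _ _

instance (a : ℝ) : SFinite (omega a) := by
  unfold omega; infer_instance

lemma ae_omega_of_forall_pos (a : ℝ) {P : ℝ → Prop} (h : ∀ x, 0 < x → P x) :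
    ∀ᵐ x ∂(omega a), P x :=
  (omega_absolutelyContinuous a).ae_le ((ae_restrict_mem measurableSet_Ioi).mono h)

variable {E : Type*} [NormedAddCommGroup E]

lemma aestronglyMeasurable_omega [SecondCountableTopology E] {f : ℝ → E}
    (hf : ContinuousOn f (Ioi 0)) : AEStronglyMeasurable f (omega a) := by
  borelize E
  exact (hf.aestronglyMeasurable measurableSet_Ioi).mono_ac (omega_absolutelyContinuous a)

variable [NormedSpace ℝ E]

lemma integral_omega (a : ℝ) (f : ℝ → E) :
    ∫ x, f x ∂(omega a) = ∫ x in Ioi 0, (x ^ a) • f x := by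
  rw [omega, integral_withDensity_eq_integral_toReal_smul (by fun_prop) (by simp)]
  exact setIntegral_congr_fun measurableSet_Ioi fun x hx => by
    rw [ENNReal.toReal_ofReal (Real.rpow_nonneg (le_of_lt hx) a)]

lemma integrable_omega_iff {f : ℝ → E} :
    Integrable f (omega a) ↔ IntegrableOn (fun x => (x ^ a) • f x) (Ioi 0) := by
  rw [omega, integrable_withDensity_iff_integrable_smul' (by fun_prop) (by simp)]
  exact integrableOn_congr_fun (fun x hx => by
    rw [ENNReal.toReal_ofReal (Real.rpow_nonneg (le_of_lt hx) a)]) measurableSet_Ioi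

lemma integral_omega_add_two (a : ℝ) (f : ℝ → ℂ) :
    ∫ x, f x ∂(omega (a + 2)) = ∫ x : ℝ, (x : ℂ) ^ 2 * f x ∂(omega a) := by
  rw [integral_omega, integral_omega]
  refine setIntegral_congr_fun measurableSet_Ioi fun x (hx : 0 < x) => ?_
  simp only [Real.rpow_add hx, Real.rpow_two, Complex.real_smul]
  push_cast
  ring

lemma integrable_inv_one_add_pow (ha : -1 < a) {N : ℕ} (hN : a + 1 < N) :
    Integrable (fun x : ℝ => ((1 + x) ^ N)⁻¹) (omega a) := by
  have hcont : ContinuousOn (fun x : ℝ => ((1 + x) ^ N)⁻¹) (Ici 0) :=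
    ContinuousOn.inv₀ (by fun_prop) fun x (hx : 0 ≤ x) => by positivity
  have h_infty : (fun x : ℝ => ((1 + x) ^ N)⁻¹) =O[atTop] (· ^ (-(N : ℝ))) := by
    refine .of_bound 1 ((eventually_gt_atTop 0).mono fun x hx => ?_)
    rw [Real.rpow_neg hx.le, Real.rpow_natCast, one_mul, norm_inv, norm_inv,
      Real.norm_of_nonneg (by positivity), Real.norm_of_nonneg (by positivity)]
    gcongr
    linarith
  have h_zero : (fun x : ℝ => ((1 + x) ^ N)⁻¹) =O[𝓝[>] 0] (· ^ (-(0 : ℝ))) := by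
    refine .of_bound 1 (eventually_mem_nhdsWithin.mono fun x (hx : 0 < x) => ?_)
    rw [neg_zero, Real.rpow_zero, norm_one, mul_one, Real.norm_of_nonneg (by positivity)]
    exact inv_le_one_of_one_le₀ (one_le_pow₀ (by linarith))
  have h := mellin_convergent_of_isBigO_scalar
    ((hcont.mono Ioi_subset_Ici_self).locallyIntegrableOn measurableSet_Ioi) h_infty hN h_zero
    (by linarith : (0 : ℝ) < a + 1)
  simpa only [add_sub_cancel_right] using integrable_omega_iff.2 h

lemma memLp_inv_one_add_pow (ha : -1 < a) {N : ℕ} (hN : a + 1 < N) :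
    MemLp (fun x : ℝ => ((1 + x) ^ N)⁻¹) 2 (omega a) := by
  refine (memLp_two_iff_integrable_sq (by fun_prop : Measurable _).aestronglyMeasurable).2 ?_
  have h := integrable_inv_one_add_pow ha
    (N := N * 2) (hN.trans_le (by exact_mod_cast Nat.le_mul_of_pos_right N two_pos))
  simpa only [← inv_pow, pow_mul] using h

end Measure

/-! ### The normalized Bessel function -/

section Bessel

variable {a : ℝ}

/-- The Taylor coefficients of the normalized Bessel function of index `a` in powers of `z ^ 2`. -/
def besselCoeff (a : ℝ) (k : ℕ) : ℝ :=
  (-1) ^ k / (4 ^ k * k.factorial * Real.Gamma ((a + 1) / 2 + k)) * 2 ^ ((1 - a) / 2)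

/-- The normalized Bessel function `z ^ (-ν) J_ν(z)` of order `ν = (a - 1) / 2`, an even entire
function of `z` and an eigenfunction of the Bessel operator `ℬ_a` with eigenvalue `-1`. -/
def normalizedBessel (a z : ℝ) : ℝ := ∑' k : ℕ, besselCoeff a k * z ^ (2 * k)

lemma rpow_mul_besselJ {z : ℝ} (hz : 0 < z) :
    z ^ ((1 - a) / 2) * besselJ ((a - 1) / 2) z = normalizedBessel a z := by
  rw [besselJ, normalizedBessel, ← tsum_mul_left]
  refine tsum_congr fun k => ?_
  have hpow : (z / 2) ^ (2 * (k : ℝ) + (a - 1) / 2) =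
      z ^ (2 * k) / 4 ^ k * (2 ^ ((1 - a) / 2) / z ^ ((1 - a) / 2)) := by
    rw [Real.rpow_add (by positivity), show (a - 1) / 2 = -((1 - a) / 2) by ring,
      Real.rpow_neg (by positivity), Real.div_rpow hz.le zero_le_two ((1 - a) / 2),
      inv_div, show 2 * (k : ℝ) = ((2 * k : ℕ) : ℝ) by push_cast; ring, Real.rpow_natCast, div_pow,
      pow_mul 2, show (2 : ℝ) ^ 2 = 4 by norm_num]
  have hz' : z ^ ((1 - a) / 2) ≠ 0 := (Real.rpow_pos_of_pos hz _).ne'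
  rw [hpow, show (a - 1) / 2 + (k : ℝ) + 1 = (a + 1) / 2 + k by ring,
    Real.Gamma_nat_eq_factorial, besselCoeff]
  field_simp

lemma besselCoeff_succ (ha : -1 < a) (k : ℕ) :
    4 * (k + 1) * ((a + 1) / 2 + k) * besselCoeff a (k + 1) = -besselCoeff a k := by
  have hs : 0 < (a + 1) / 2 + k := add_pos_of_pos_of_nonneg (by linarith) k.cast_nonneg
  have hG := (Real.Gamma_pos_of_pos hs).ne'
  simp only [besselCoeff, Nat.factorial_succ, Nat.cast_mul, Nat.cast_succ, ← add_assoc,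
    Real.Gamma_add_one hs.ne', pow_succ]
  generalize (a + 1) / 2 + (k : ℝ) = s at *
  field_simp

lemma besselCoeff_add_two (a : ℝ) (k : ℕ) :
    besselCoeff (a + 2) k = -(2 * (k + 1) * besselCoeff a (k + 1)) := by
  simp only [besselCoeff, Nat.factorial_succ, Nat.cast_mul, Nat.cast_succ, pow_succ]
  rw [show (a + 2 + 1) / 2 + (k : ℝ) = (a + 1) / 2 + (k + 1) by ring,
    show (1 - (a + 2)) / 2 = (1 - a) / 2 - 1 by ring, Real.rpow_sub two_pos, Real.rpow_one]
  field_simp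
  ring

lemma summable_normalizedBessel (ha : -1 < a) (z : ℝ) :
    Summable fun k => besselCoeff a k * z ^ (2 * k) := by
  refine summable_of_ratio_norm_eventually_le (r := 1 / 2) (by norm_num) ?_
  filter_upwards [eventually_ge_atTop 1, eventually_ge_atTop ⌈z ^ 2⌉₊] with k hk hkz
  have hk : (1 : ℝ) ≤ k := by exact_mod_cast hk
  have hs : 0 < (a + 1) / 2 := by linarith
  have hratio : besselCoeff a (k + 1) * (4 * (k + 1) * ((a + 1) / 2 + k)) = -besselCoeff a k := by
    rw [← besselCoeff_succ ha k]; ring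
  rw [← neg_eq_iff_eq_neg] at hratio
  have hz : 2 * z ^ 2 ≤ 4 * (k + 1) * ((a + 1) / 2 + k) := by
    nlinarith [Nat.ceil_le.1 hkz]
  rw [← hratio, norm_mul, norm_mul, norm_neg, norm_mul, mul_add, pow_add,
    norm_mul, Real.norm_of_nonneg (by positivity : (0 : ℝ) ≤ 4 * (k + 1) * ((a + 1) / 2 + k)),
    Real.norm_of_nonneg (even_two_mul 1 |>.pow_nonneg z)]
  have : 0 ≤ ‖besselCoeff a (k + 1)‖ * ‖z ^ (2 * k)‖ := by positivity
  nlinarith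

lemma normalizedBessel_eq_zero_add (ha : -1 < a) (z : ℝ) : normalizedBessel a z =
    besselCoeff a 0 + ∑' k : ℕ, besselCoeff a (k + 1) * z ^ (2 * (k + 1)) := by
  rw [normalizedBessel, (summable_normalizedBessel ha z).tsum_eq_zero_add, mul_zero, pow_zero,
    mul_one]

lemma hasDerivAt_normalizedBessel (ha : -1 < a) (z : ℝ) :
    HasDerivAt (normalizedBessel a) (-z * normalizedBessel (a + 2) z) z := by
  have ha₂ : -1 < a + 2 := by linarith
  set R : ℝ := |z| + 1
  have hR : 0 < R := by positivity
  have hterm : ∀ (k : ℕ) (y : ℝ), HasDerivAt (fun y => besselCoeff a (k + 1) * y ^ (2 * (k + 1)))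
      (-y * (besselCoeff (a + 2) k * y ^ (2 * k))) y := fun k y => by
    refine ((hasDerivAt_pow (2 * (k + 1)) y).const_mul _).congr_deriv ?_
    rw [besselCoeff_add_two, show 2 * (k + 1) - 1 = 2 * k + 1 by omega]
    push_cast
    ring
  have hbound : ∀ (k : ℕ) (y : ℝ), y ∈ Metric.ball 0 R →
      ‖-y * (besselCoeff (a + 2) k * y ^ (2 * k))‖ ≤ R * ‖besselCoeff (a + 2) k * R ^ (2 * k)‖ :=
    fun k y hy => by
      have hy : |y| ≤ R := by simpa using (Metric.mem_ball.1 hy).le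
      rw [norm_mul, norm_neg, norm_mul, norm_mul, norm_pow, norm_pow, Real.norm_eq_abs y,
        Real.norm_eq_abs R, abs_of_pos hR]
      gcongr
  have hz : z ∈ Metric.ball 0 R := by simp [R]
  have h := hasDerivAt_tsum_of_isPreconnected
    ((summable_normalizedBessel ha₂ R).norm.mul_left R) Metric.isOpen_ball
    (convex_ball 0 R).isPreconnected (fun k y _ => hterm k y) hbound hz
    ((summable_nat_add_iff 1).2 (summable_normalizedBessel ha z)) hz
  rw [tsum_mul_left] at h
  exact (h.const_add (besselCoeff a 0)).congr_of_eventuallyEq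
    (.of_forall (normalizedBessel_eq_zero_add ha))

lemma continuous_normalizedBessel (ha : -1 < a) : Continuous (normalizedBessel a) :=
  continuous_iff_continuousAt.2 fun z => (hasDerivAt_normalizedBessel ha z).continuousAt

lemma normalizedBessel_recurrence (ha : -1 < a) (z : ℝ) : normalizedBessel a z =
    (1 + a) * normalizedBessel (a + 2) z - z ^ 2 * normalizedBessel (a + 2 + 2) z := by
  have ha₂ : -1 < a + 2 := by linarith
  have h_zero : besselCoeff a 0 = (1 + a) * besselCoeff (a + 2) 0 := by
    have := besselCoeff_succ ha 0
    rw [besselCoeff_add_two]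
    push_cast at this ⊢
    linarith
  have h_succ : ∀ k, besselCoeff a (k + 1) =
      (1 + a) * besselCoeff (a + 2) (k + 1) - besselCoeff (a + 2 + 2) k := fun k => by
    have := besselCoeff_succ ha (k + 1)
    rw [besselCoeff_add_two (a + 2), besselCoeff_add_two a (k + 1)]
    push_cast at this ⊢
    linarith
  have hs := (summable_nat_add_iff 1).2 (summable_normalizedBessel ha₂ z)
  have hs' := summable_normalizedBessel (show -1 < a + 2 + 2 by linarith) z
  rw [normalizedBessel_eq_zero_add ha, normalizedBessel_eq_zero_add ha₂, normalizedBessel, mul_add,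
    ← tsum_mul_left, ← tsum_mul_left, add_sub_assoc,
    ← (hs.mul_left (1 + a)).tsum_sub (hs'.mul_left _), h_zero]
  congr 2 with k
  rw [h_succ]
  ring

lemma normalizedBessel_neg (a z : ℝ) : normalizedBessel a (-z) = normalizedBessel a z := by
  simp only [normalizedBessel, pow_mul, neg_sq]

/-- The energy `E_a(z)² + E_a'(z)²` of `E_a = normalizedBessel a` decreases in `z ≥ 0` when the
damping `a` in `E_a'' + (a/z) E_a' = -E_a` is nonnegative. -/
lemma abs_normalizedBessel_le (ha : 0 ≤ a) (z : ℝ) :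
    |normalizedBessel a z| ≤ |normalizedBessel a 0| := by
  wlog hz : 0 ≤ z generalizing z
  · rw [← normalizedBessel_neg]
    exact this (-z) (by linarith)
  have hderiv : ∀ z, HasDerivAt
      (fun z => normalizedBessel a z ^ 2 + (z * normalizedBessel (a + 2) z) ^ 2)
      (-(2 * a * z * normalizedBessel (a + 2) z ^ 2)) z := fun z => by
    refine (((hasDerivAt_normalizedBessel (by linarith) z).pow 2).add
      (((hasDerivAt_id z).mul (hasDerivAt_normalizedBessel (by linarith) z)).pow 2)).congr_deriv ?_
    rw [normalizedBessel_recurrence (by linarith) z]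
    simp only [id, Pi.mul_apply]
    ring
  have hanti : AntitoneOn
      (fun z => normalizedBessel a z ^ 2 + (z * normalizedBessel (a + 2) z) ^ 2) (Ici 0) := by
    refine antitoneOn_of_hasDerivWithinAt_nonpos (convex_Ici 0)
      (fun z _ => (hderiv z).continuousAt.continuousWithinAt)
      (fun z _ => (hderiv z).hasDerivWithinAt) fun z hz => ?_
    rw [interior_Ici, mem_Ioi] at hz
    exact neg_nonpos.2 (by positivity)
  have h := hanti self_mem_Ici hz hz
  simp only [zero_mul] at h
  exact sq_le_sq.1 (by nlinarith [sq_nonneg (z * normalizedBessel (a + 2) z)])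

/-- The recurrence relation reduces the bound to the nonnegative indices `a + 2`, `a + 4`. -/
lemma exists_abs_normalizedBessel_le (ha : -1 < a) :
    ∃ C, 0 ≤ C ∧ ∀ z, |normalizedBessel a z| ≤ C * (1 + |z|) ^ 2 := by
  set A := |normalizedBessel (a + 2) 0|
  set B := |normalizedBessel (a + 2 + 2) 0|
  have ha₁ : 0 ≤ 1 + a := by linarith
  refine ⟨(1 + a) * A + B, by positivity, fun z => ?_⟩
  calc |normalizedBessel a z|
    _ ≤ (1 + a) * |normalizedBessel (a + 2) z| + z ^ 2 * |normalizedBessel (a + 2 + 2) z| := by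
      rw [normalizedBessel_recurrence ha z]
      refine (abs_sub _ _).trans_eq ?_
      rw [abs_mul, abs_mul, abs_of_nonneg ha₁, abs_sq]
    _ ≤ (1 + a) * A + z ^ 2 * B := by
      gcongr
      · exact abs_normalizedBessel_le (by linarith) z
      · exact abs_normalizedBessel_le (by linarith) z
    _ ≤ ((1 + a) * A + B) * (1 + |z|) ^ 2 := by
      have hA : 0 ≤ (1 + a) * A := by positivity
      have hB : 0 ≤ B := abs_nonneg _
      rw [← sq_abs z]
      nlinarith [abs_nonneg z, mul_nonneg hA (abs_nonneg z), mul_nonneg hB (abs_nonneg z),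
        mul_nonneg hA (sq_nonneg |z|)]

end Bessel

/-! ### Families of rapidly decreasing functions -/

section Families

variable {ι κ : Type*} {φ ψ : ι → ℝ → ℂ} {n : ℕ}

/-- `g = (1/x) f'` on the half-line. -/
def HasRadialDeriv (f g : ℝ → ℂ) : Prop := ∀ x : ℝ, 0 < x → HasDerivAt f (x * g x) x

/-- Polynomial growth on the half-line, uniformly over a family of functions. -/
def PolyGrowth (φ : ι → ℝ → ℂ) : Prop :=
  ∃ (N : ℕ) (C : ℝ), ∀ i x, 0 < x → ‖φ i x‖ ≤ C * (1 + x) ^ N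

/-- Rapid decay on the half-line, uniformly over a family of functions. -/
def RapidDecay (φ : ι → ℝ → ℂ) : Prop :=
  ∀ m : ℕ, ∃ C : ℝ, ∀ i x, 0 < x → ‖φ i x‖ ≤ C * ((1 + x) ^ m)⁻¹

/-- The families `φ`, `(1/x) ∂ₓ φ`, …, `((1/x) ∂ₓ) ^ n φ` exist, are continuous on the half-line and
satisfy the growth condition `P`. -/
def RadialChain (P : (ι → ℝ → ℂ) → Prop) : ℕ → (ι → ℝ → ℂ) → Prop
  | 0, φ => P φ ∧ ∀ i, ContinuousOn (φ i) (Ioi 0)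
  | n + 1, φ => P φ ∧ ∃ ψ, RadialChain P n ψ ∧ ∀ i, HasRadialDeriv (φ i) (ψ i)

/-- A family of functions in the class `𝒮⁺` with uniform bounds. Smoothness is encoded by the
existence of all iterates of `(1/x) ∂ₓ`. -/
def SchwartzFamily (φ : ι → ℝ → ℂ) : Prop := ∀ n, RadialChain RapidDecay n φ

section HasRadialDeriv

variable {f f₁ f₂ g g₁ : ℝ → ℂ}

lemma HasRadialDeriv.continuousOn (h : HasRadialDeriv f f₁) : ContinuousOn f (Ioi 0) :=
  fun x hx => (h x hx).continuousAt.continuousWithinAt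

lemma HasRadialDeriv.add (hf : HasRadialDeriv f f₁) (hg : HasRadialDeriv g g₁) :
    HasRadialDeriv (fun x => f x + g x) fun x => f₁ x + g₁ x :=
  fun x hx => ((hf x hx).add (hg x hx)).congr_deriv (by ring)

lemma HasRadialDeriv.mul (hf : HasRadialDeriv f f₁) (hg : HasRadialDeriv g g₁) :
    HasRadialDeriv (fun x => f x * g x) fun x => f₁ x * g x + f x * g₁ x :=
  fun x hx => ((hf x hx).mul (hg x hx)).congr_deriv (by ring)

lemma HasRadialDeriv.congr (h : HasRadialDeriv f f₁) (hfg : EqOn f g (Ioi 0)) :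
    HasRadialDeriv g f₁ :=
  fun x hx => (h x hx).congr_of_eventuallyEq
    (eventually_of_mem (Ioi_mem_nhds hx) fun _ hy => (hfg hy).symm)

lemma HasRadialDeriv.besselOp_eq {a : ℝ} (hf : HasRadialDeriv f f₁) (hf₁ : HasRadialDeriv f₁ f₂)
    {x : ℝ} (hx : 0 < x) : besselOp a f x = (x : ℂ) ^ 2 * f₂ x + (1 + a) * f₁ x := by
  have hx' : (x : ℂ) ≠ 0 := Complex.ofReal_ne_zero.2 hx.ne'
  have hderiv : deriv f =ᶠ[𝓝 x] fun y => y * f₁ y :=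
    eventually_of_mem (Ioi_mem_nhds hx) fun y hy => (hf y hy).deriv
  rw [besselOp, hderiv.deriv_eq, hderiv.eq_of_nhds,
    ((hasDerivAt_id' x).ofReal_comp.fun_mul (hf₁ x hx)).deriv]
  push_cast
  field_simp
  ring

end HasRadialDeriv

lemma RapidDecay.comp (h : RapidDecay φ) (r : κ → ι) : RapidDecay fun k => φ (r k) :=
  fun m => (h m).imp fun _ hC k => hC (r k)

lemma RapidDecay.add (hφ : RapidDecay φ) (hψ : RapidDecay ψ) :
    RapidDecay fun i x => φ i x + ψ i x := by
  intro m
  obtain ⟨C, hC⟩ := hφ m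
  obtain ⟨D, hD⟩ := hψ m
  refine ⟨C + D, fun i x hx => (norm_add_le _ _).trans ?_⟩
  rw [add_mul]
  exact add_le_add (hC i x hx) (hD i x hx)

lemma RapidDecay.mul (hφ : RapidDecay φ) (hψ : PolyGrowth ψ) :
    RapidDecay fun i x => φ i x * ψ i x := by
  intro m
  obtain ⟨N, D, hD⟩ := hψ
  obtain ⟨C, hC⟩ := hφ (m + N)
  refine ⟨C * D, fun i x hx => ?_⟩
  calc ‖φ i x * ψ i x‖ ≤ C * ((1 + x) ^ (m + N))⁻¹ * (D * (1 + x) ^ N) := by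
        rw [norm_mul]
        exact mul_le_mul (hC i x hx) (hD i x hx) (norm_nonneg _)
          ((norm_nonneg _).trans (hC i x hx))
    _ = C * D * ((1 + x) ^ m)⁻¹ := by rw [pow_add]; field_simp

lemma RapidDecay.integrable {a : ℝ} (ha : -1 < a) (h : RapidDecay φ) (i : ι)
    (hc : ContinuousOn (φ i) (Ioi 0)) : Integrable (φ i) (omega a) := by
  obtain ⟨N, hN⟩ := exists_nat_gt (a + 1)
  obtain ⟨C, hC⟩ := h N
  exact ((integrable_inv_one_add_pow ha hN).const_mul C).mono' (aestronglyMeasurable_omega hc)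
    (ae_omega_of_forall_pos a (hC i))

namespace RadialChain

variable {P : (ι → ℝ → ℂ) → Prop}

lemma growth (h : RadialChain P n φ) : P φ := by
  cases n <;> exact h.1

lemma continuousOn (h : RadialChain P n φ) (i : ι) : ContinuousOn (φ i) (Ioi 0) := by
  cases n with
  | zero => exact h.2 i
  | succ n =>
    obtain ⟨-, ψ, -, hd⟩ := h
    exact (hd i).continuousOn

lemma of_succ (h : RadialChain P (n + 1) φ) : RadialChain P n φ := by
  induction n generalizing φ with
  | zero => exact ⟨h.growth, h.continuousOn⟩
  | succ n ih =>
    obtain ⟨h_growth, ψ, hψ, hd⟩ := h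
    exact ⟨h_growth, ψ, ih hψ, hd⟩

lemma comp (h : RadialChain RapidDecay n φ) (r : κ → ι) :
    RadialChain RapidDecay n fun k => φ (r k) := by
  induction n generalizing φ with
  | zero => exact ⟨h.1.comp r, fun k => h.2 (r k)⟩
  | succ n ih =>
    obtain ⟨h_growth, ψ, hψ, hd⟩ := h
    exact ⟨h_growth.comp r, fun k => ψ (r k), ih hψ, fun k => hd (r k)⟩

lemma add (hφ : RadialChain RapidDecay n φ) (hψ : RadialChain RapidDecay n ψ) :
    RadialChain RapidDecay n fun i x => φ i x + ψ i x := by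
  induction n generalizing φ ψ with
  | zero => exact ⟨hφ.1.add hψ.1, fun i => (hφ.2 i).add (hψ.2 i)⟩
  | succ n ih =>
    obtain ⟨hφ_growth, φ', hφ', hφd⟩ := hφ
    obtain ⟨hψ_growth, ψ', hψ', hψd⟩ := hψ
    exact ⟨hφ_growth.add hψ_growth, _, ih hφ' hψ', fun i => (hφd i).add (hψd i)⟩

lemma mul (hφ : RadialChain RapidDecay n φ) (hψ : RadialChain PolyGrowth n ψ) :
    RadialChain RapidDecay n fun i x => φ i x * ψ i x := by
  induction n generalizing φ ψ with
  | zero => exact ⟨hφ.1.mul hψ.1, fun i => (hφ.2 i).mul (hψ.2 i)⟩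
  | succ n ih =>
    have hφ₀ := hφ.of_succ
    have hψ₀ := hψ.of_succ
    obtain ⟨hφ_growth, φ', hφ', hφd⟩ := hφ
    obtain ⟨hψ_growth, ψ', hψ', hψd⟩ := hψ
    exact ⟨hφ_growth.mul hψ_growth, _, (ih hφ' hψ₀).add (ih hφ₀ hψ'),
      fun i => (hφd i).mul (hψd i)⟩

lemma congr (h : RadialChain RapidDecay n φ) (heq : ∀ i, EqOn (φ i) (ψ i) (Ioi 0)) :
    RadialChain RapidDecay n ψ := by
  have hψ : RapidDecay ψ := fun m => (h.growth m).imp fun C hC i x hx => by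
    rw [← heq i hx]
    exact hC i x hx
  cases n with
  | zero => exact ⟨hψ, fun i => (h.2 i).congr (heq i).symm⟩
  | succ n =>
    obtain ⟨-, φ', hφ', hd⟩ := h
    exact ⟨hψ, φ', hφ', fun i => (hd i).congr (heq i)⟩

end RadialChain

lemma hasRadialDeriv_cexp_mul_sq (c : ℂ) :
    HasRadialDeriv (fun x => Complex.exp (c * (x : ℂ) ^ 2))
      fun x => 2 * c * Complex.exp (c * (x : ℂ) ^ 2) := fun x _ => by
  refine ((hasDerivAt_id' x).ofReal_comp.fun_pow 2 |>.const_mul c).cexp.congr_deriv ?_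
  push_cast
  ring

lemma polyGrowth_mul_cexp {c k : ι → ℂ} {K : ℝ} (hre : ∀ i, (c i).re ≤ 0) (hk : ∀ i, ‖k i‖ ≤ K) :
    PolyGrowth fun i (x : ℝ) => k i * Complex.exp (c i * (x : ℂ) ^ 2) := by
  refine ⟨0, K, fun i x _ => ?_⟩
  have hexp : ‖Complex.exp (c i * (x : ℂ) ^ 2)‖ ≤ 1 := by
    rw [Complex.norm_exp, ← Complex.ofReal_pow, Complex.re_mul_ofReal, Real.exp_le_one_iff]
    exact mul_nonpos_of_nonpos_of_nonneg (hre i) (sq_nonneg x)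
  rw [norm_mul, pow_zero]
  exact mul_le_mul (hk i) hexp (norm_nonneg _) ((norm_nonneg _).trans (hk i))

lemma radialChain_mul_cexp {c k : ι → ℂ} {M K : ℝ} (hc : ∀ i, ‖c i‖ ≤ M)
    (hre : ∀ i, (c i).re ≤ 0) (hk : ∀ i, ‖k i‖ ≤ K) (n : ℕ) :
    RadialChain PolyGrowth n fun i (x : ℝ) => k i * Complex.exp (c i * (x : ℂ) ^ 2) := by
  induction n generalizing k K with
  | zero => exact ⟨polyGrowth_mul_cexp hre hk, fun i => by fun_prop⟩
  | succ n ih =>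
    have hk' : ∀ i, ‖k i * (2 * c i)‖ ≤ K * (2 * M) := fun i => by
      rw [norm_mul, norm_mul, Complex.norm_ofNat]
      have hK := (norm_nonneg _).trans (hk i)
      gcongr
      exacts [hk i, hc i]
    exact ⟨polyGrowth_mul_cexp hre hk, _, ih hk', fun i x hx =>
      (hasRadialDeriv_cexp_mul_sq (c i) x hx |>.const_mul (k i)).congr_deriv (by ring)⟩

lemma radialChain_const (c : ℂ) (n : ℕ) :
    RadialChain PolyGrowth n fun (_ : ι) (_ : ℝ) => c := by
  simpa using radialChain_mul_cexp (ι := ι) (c := 0) (k := fun _ => c) (M := 0) (by simp)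
    (by simp) (fun _ => le_rfl) n

lemma radialChain_sq (n : ℕ) : RadialChain PolyGrowth n fun (_ : ι) (x : ℝ) => (x : ℂ) ^ 2 := by
  have h_growth : PolyGrowth fun (_ : ι) (x : ℝ) => (x : ℂ) ^ 2 := by
    refine ⟨2, 1, fun _ x hx => ?_⟩
    rw [norm_pow, Complex.norm_real, Real.norm_of_nonneg hx.le, one_mul]
    gcongr
    linarith
  cases n with
  | zero => exact ⟨h_growth, fun _ => by fun_prop⟩
  | succ n =>
    refine ⟨h_growth, _, radialChain_const 2 n, fun _ x _ => ?_⟩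
    refine ((hasDerivAt_id' x).ofReal_comp.fun_pow 2).congr_deriv ?_
    push_cast
    ring

namespace RadialChain

lemma const_mul (h : RadialChain RapidDecay n φ) (c : ℂ) :
    RadialChain RapidDecay n fun i x => c * φ i x := by
  simpa only [mul_comm c] using h.mul (radialChain_const c n)

lemma sq_mul (h : RadialChain RapidDecay n φ) :
    RadialChain RapidDecay n fun i x => (x : ℂ) ^ 2 * φ i x := by
  simpa only [mul_comm] using h.mul (radialChain_sq n)

lemma besselOp (a : ℝ) (h : RadialChain RapidDecay (n + 2) φ) :
    RadialChain RapidDecay n fun i => besselOp a (φ i) := by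
  obtain ⟨-, φ₁, ⟨hφ₁_growth, φ₂, hφ₂, hd₁⟩, hd⟩ := h
  have hφ₁ : RadialChain RapidDecay n φ₁ := of_succ ⟨hφ₁_growth, φ₂, hφ₂, hd₁⟩
  exact (hφ₂.sq_mul.add (hφ₁.const_mul (1 + a))).congr fun i x hx =>
    ((hd i).besselOp_eq (hd₁ i) hx).symm

lemma integrable {a : ℝ} (ha : -1 < a) (h : RadialChain RapidDecay n φ) (i : ι) :
    Integrable (φ i) (omega a) :=
  h.growth.integrable ha i (h.continuousOn i)

end RadialChain

lemma SchwartzFamily.comp (h : SchwartzFamily φ) (r : κ → ι) : SchwartzFamily fun k => φ (r k) :=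
  fun n => (h n).comp r

lemma SchwartzFamily.iterate_besselOp (a : ℝ) (h : SchwartzFamily φ) (m : ℕ) :
    SchwartzFamily fun i => (besselOp a)^[m] (φ i) := by
  induction m with
  | zero => exact h
  | succ m ih =>
    simp only [Function.iterate_succ_apply']
    exact fun n => (ih (n + 2)).besselOp a

end Families

/-! ### Green's identity -/

section Green

variable {ι : Type*} {a : ℝ} {f g : ι → ℝ → ℂ}

lemma RapidDecay.tendsto_rpow_mul_nhdsGT_zero (ha : 0 < a) (h : RapidDecay f) (i : ι) :
    Tendsto (fun x : ℝ => ((x ^ a : ℝ) : ℂ) * f i x) (𝓝[>] 0) (𝓝 0) := by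
  obtain ⟨C, hC⟩ := h 0
  have hpow : Tendsto (fun x : ℝ => x ^ a * C) (𝓝[>] 0) (𝓝 0) := by
    have := (Real.continuousAt_rpow_const 0 a (Or.inr ha.le)).tendsto
    rw [Real.zero_rpow ha.ne'] at this
    simpa using (this.mono_left nhdsWithin_le_nhds).mul_const C
  refine squeeze_zero_norm' (eventually_mem_nhdsWithin.mono fun x (hx : 0 < x) => ?_) hpow
  rw [norm_mul, Complex.norm_real, Real.norm_of_nonneg (by positivity)]
  gcongr
  simpa using hC i x hx

lemma RapidDecay.tendsto_rpow_mul_atTop (a : ℝ) (h : RapidDecay f) (i : ι) :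
    Tendsto (fun x : ℝ => ((x ^ a : ℝ) : ℂ) * f i x) atTop (𝓝 0) := by
  obtain ⟨N, hN⟩ := exists_nat_gt a
  obtain ⟨C, hC⟩ := h N
  have hpow : Tendsto (fun x : ℝ => C * x ^ (-(N - a))) atTop (𝓝 0) := by
    simpa using (tendsto_rpow_neg_atTop (sub_pos.2 hN)).const_mul C
  refine squeeze_zero_norm' ((eventually_gt_atTop 0).mono fun x hx => ?_) hpow
  have hC0 : 0 ≤ C := nonneg_of_mul_nonneg_left ((norm_nonneg _).trans (hC i x hx)) (by positivity)
  rw [norm_mul, Complex.norm_real, Real.norm_of_nonneg (by positivity)]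
  calc x ^ a * ‖f i x‖ ≤ x ^ a * (C * (x ^ N)⁻¹) := by
        gcongr
        refine (hC i x hx).trans ?_
        gcongr
        linarith
    _ = C * x ^ (-(N - a)) := by
      rw [neg_sub, Real.rpow_sub hx, Real.rpow_natCast]
      ring

/-- The divergence theorem: the integrand is `x ^ (-a) (x ^ (a + 1) f)'`. -/
lemma integral_sq_mul_add_eq_zero {f₁ : ι → ℝ → ℂ} (ha : -1 < a) (hf : RapidDecay f)
    (hf₁ : RadialChain RapidDecay 0 f₁) (hd : ∀ i, HasRadialDeriv (f i) (f₁ i)) (i : ι) :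
    ∫ x : ℝ, (x : ℂ) ^ 2 * f₁ i x + (1 + a) * f i x ∂(omega a) = 0 := by
  have hf₀ : RadialChain RapidDecay 0 f := ⟨hf, fun i => (hd i).continuousOn⟩
  have hint := integrable_omega_iff.1 ((hf₁.sq_mul.add (hf₀.const_mul (1 + a))).integrable ha i)
  have hderiv : ∀ x ∈ Ioi (0 : ℝ), HasDerivAt (fun x : ℝ => ((x ^ (a + 1) : ℝ) : ℂ) * f i x)
      (x ^ a • ((x : ℂ) ^ 2 * f₁ i x + (1 + a) * f i x)) x := fun x (hx : 0 < x) => by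
    refine ((Real.hasDerivAt_rpow_const (Or.inl hx.ne')).ofReal_comp.mul
      (hd i x hx)).congr_deriv ?_
    rw [add_sub_cancel_right, Real.rpow_add_one hx.ne', Complex.real_smul]
    push_cast
    ring
  have hcont : ContinuousWithinAt (fun x : ℝ => ((x ^ (a + 1) : ℝ) : ℂ) * f i x) (Ici 0) 0 := by
    refine continuousWithinAt_Ioi_iff_Ici.1 ?_
    have := hf.tendsto_rpow_mul_nhdsGT_zero (a := a + 1) (by linarith) i
    rwa [ContinuousWithinAt, Real.zero_rpow (by linarith), Complex.ofReal_zero, zero_mul]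
  rw [integral_omega, integral_Ioi_of_hasDerivAt_of_tendsto hcont hderiv hint
    (hf.tendsto_rpow_mul_atTop _ i), Real.zero_rpow (by linarith), Complex.ofReal_zero, zero_mul,
    sub_zero]

theorem integral_besselOp_mul (ha : -1 < a) (hf : RadialChain RapidDecay 2 f)
    (hg : RadialChain PolyGrowth 2 g) (i : ι) :
    ∫ x, besselOp a (f i) x * g i x ∂(omega a) = ∫ x, f i x * besselOp a (g i) x ∂(omega a) := by
  obtain ⟨-, f₁, hf₁, hfd⟩ := id hf
  obtain ⟨-, g₁, hg₁, hgd⟩ := id hg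
  obtain ⟨-, f₂, hf₂, hfd₁⟩ := id hf₁
  obtain ⟨-, g₂, hg₂, hgd₁⟩ := id hg₁
  have hw : RadialChain RapidDecay 0 fun i x => f₁ i x * g i x + (-1) * (f i x * g₁ i x) :=
    (hf₁.of_succ.mul hg.of_succ.of_succ).add ((hf.of_succ.of_succ.mul hg₁.of_succ).const_mul _)
  have hw₁ : RadialChain RapidDecay 0 fun i x => f₂ i x * g i x + (-1) * (f i x * g₂ i x) :=
    (hf₂.mul hg.of_succ.of_succ).add ((hf.of_succ.of_succ.mul hg₂).const_mul _)
  have hBf : RadialChain RapidDecay 0 fun i x =>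
      ((x : ℂ) ^ 2 * f₂ i x + (1 + a) * f₁ i x) * g i x :=
    (hf₂.sq_mul.add (hf₁.of_succ.const_mul _)).mul hg.of_succ.of_succ
  have hBg : RadialChain RapidDecay 0 fun i x =>
      (x : ℂ) ^ 2 * (f i x * g₂ i x) + (1 + a) * (f i x * g₁ i x) :=
    (hf.of_succ.of_succ.mul hg₂).sq_mul.add ((hf.of_succ.of_succ.mul hg₁.of_succ).const_mul _)
  have key := integral_sq_mul_add_eq_zero ha hw.growth hw₁ (fun i x hx =>
    (((hfd₁ i x hx).mul (hgd i x hx)).add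
      (((hfd i x hx).mul (hgd₁ i x hx)).const_mul (-1))).congr_deriv (by ring)) i
  have hBf_eq := integral_congr_ae (ae_omega_of_forall_pos a fun x hx =>
    congrArg (· * g i x) ((hfd i).besselOp_eq (a := a) (hfd₁ i) hx))
  have hBg_eq := integral_congr_ae (ae_omega_of_forall_pos a fun x hx =>
    (congrArg (f i x * ·) ((hgd i).besselOp_eq (a := a) (hgd₁ i) hx)).trans
      (show _ = (x : ℂ) ^ 2 * (f i x * g₂ i x) + (1 + a) * (f i x * g₁ i x) by ring))
  rw [hBf_eq, hBg_eq, ← sub_eq_zero, ← integral_sub (hBf.integrable ha i) (hBg.integrable ha i),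
    ← key]
  congr with x
  ring

end Green

/-! ### The Hankel transform -/

section Hankel

variable {ι : Type*} {a : ℝ} {φ : ι → ℝ → ℂ}

/-- The Hankel transform of order `ν = (a - 1) / 2`, normalized with the kernel
`(ξ y) ^ (-ν) J_ν(ξ y)`. -/
def hankel (a : ℝ) (φ : ℝ → ℂ) (ξ : ℝ) : ℂ :=
  ∫ y, (normalizedBessel a (ξ * y) : ℂ) * φ y ∂(omega a)

lemma exists_abs_normalizedBessel_mul_le (ha : -1 < a) :
    ∃ C, 0 ≤ C ∧ ∀ ξ y, 0 < y → |normalizedBessel a (ξ * y)| ≤ C * (1 + |ξ|) ^ 2 * (1 + y) ^ 2 := by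
  obtain ⟨C, hC0, hC⟩ := exists_abs_normalizedBessel_le ha
  refine ⟨C, hC0, fun ξ y hy => (hC (ξ * y)).trans ?_⟩
  rw [mul_assoc, ← mul_pow, abs_mul, abs_of_pos hy]
  gcongr
  nlinarith [abs_nonneg ξ]

lemma hasRadialDeriv_normalizedBessel (ha : -1 < a) (ξ : ℝ) :
    HasRadialDeriv (fun y => (normalizedBessel a (ξ * y) : ℂ))
      fun y => -(ξ : ℂ) ^ 2 * (normalizedBessel (a + 2) (ξ * y) : ℂ) := fun y _ => by
  refine ((hasDerivAt_normalizedBessel ha (ξ * y)).comp y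
    ((hasDerivAt_id' y).const_mul ξ)).ofReal_comp.congr_deriv ?_
  push_cast
  ring

lemma polyGrowth_normalizedBessel (ha : -1 < a) (ξ : ℝ) (c : ℂ) :
    PolyGrowth fun (_ : ι) y => c * (normalizedBessel a (ξ * y) : ℂ) := by
  obtain ⟨C, -, hC⟩ := exists_abs_normalizedBessel_mul_le ha
  refine ⟨2, ‖c‖ * (C * (1 + |ξ|) ^ 2), fun _ y hy => ?_⟩
  rw [norm_mul, Complex.norm_real, mul_assoc]
  gcongr
  exact hC ξ y hy

lemma radialChain_normalizedBessel (ha : -1 < a) (ξ : ℝ) (c : ℂ) (n : ℕ) :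
    RadialChain PolyGrowth n fun (_ : ι) y => c * (normalizedBessel a (ξ * y) : ℂ) := by
  have h_growth := polyGrowth_normalizedBessel (ι := ι) ha ξ c
  have hd := hasRadialDeriv_normalizedBessel ha ξ
  induction n generalizing a c with
  | zero => exact ⟨h_growth, fun _ => hd.continuousOn.const_smul c⟩
  | succ n ih =>
    have ha₂ : -1 < a + 2 := by linarith
    exact ⟨h_growth, _, ih ha₂ (c * -(ξ : ℂ) ^ 2) (polyGrowth_normalizedBessel ha₂ ξ _)
      (hasRadialDeriv_normalizedBessel ha₂ ξ),
      fun _ y hy => ((hd y hy).const_mul c).congr_deriv (by ring)⟩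

lemma besselOp_normalizedBessel (ha : -1 < a) (ξ : ℝ) {y : ℝ} (hy : 0 < y) :
    besselOp a (fun y => (normalizedBessel a (ξ * y) : ℂ)) y =
      -(ξ : ℂ) ^ 2 * (normalizedBessel a (ξ * y) : ℂ) := by
  have hd := hasRadialDeriv_normalizedBessel (a := a + 2) (by linarith) ξ
  rw [(hasRadialDeriv_normalizedBessel ha ξ).besselOp_eq (fun y hy =>
    ((hd y hy).const_mul (-(ξ : ℂ) ^ 2)).congr_deriv (mul_left_comm _ _ _)) hy,
    normalizedBessel_recurrence ha]
  push_cast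
  ring

lemma integrable_normalizedBessel_mul {b : ℝ} (ha : -1 < a) (hb : -1 < b)
    (h : RadialChain RapidDecay 0 φ) (i : ι) (ξ : ℝ) :
    Integrable (fun y => (normalizedBessel b (ξ * y) : ℂ) * φ i y) (omega a) := by
  simpa only [one_mul, mul_comm (φ i _)] using
    (h.mul (radialChain_normalizedBessel hb ξ 1 0)).integrable ha i

lemma hankel_add_two (a : ℝ) (f : ℝ → ℂ) (ξ : ℝ) : hankel (a + 2) f ξ =
    ∫ y : ℝ, (normalizedBessel (a + 2) (ξ * y) : ℂ) * ((y : ℂ) ^ 2 * f y) ∂(omega a) := by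
  simp only [hankel, integral_omega_add_two, mul_left_comm]

lemma RapidDecay.exists_norm_normalizedBessel_mul_le (ha : -1 < a) (h : RapidDecay φ) (m : ℕ) :
    ∃ C, 0 ≤ C ∧ ∀ i ξ y, 0 < y →
      ‖(normalizedBessel a (ξ * y) : ℂ) * φ i y‖ ≤ C * (1 + |ξ|) ^ 2 * ((1 + y) ^ m)⁻¹ := by
  obtain ⟨C, hC0, hC⟩ := exists_abs_normalizedBessel_mul_le ha
  obtain ⟨D, hD⟩ := h (m + 2)
  refine ⟨C * |D|, by positivity, fun i ξ y hy => ?_⟩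
  calc ‖(normalizedBessel a (ξ * y) : ℂ) * φ i y‖
    _ ≤ C * (1 + |ξ|) ^ 2 * (1 + y) ^ 2 * (|D| * ((1 + y) ^ (m + 2))⁻¹) := by
      rw [norm_mul, Complex.norm_real]
      gcongr
      · exact hC ξ y hy
      · refine (hD i y hy).trans ?_
        gcongr
        exact le_abs_self D
    _ = C * |D| * (1 + |ξ|) ^ 2 * ((1 + y) ^ m)⁻¹ := by rw [pow_add]; field_simp

lemma RapidDecay.exists_norm_hankel_le (ha : -1 < a) (h : RapidDecay φ) :
    ∃ C, 0 ≤ C ∧ ∀ i ξ, ‖hankel a (φ i) ξ‖ ≤ C * (1 + |ξ|) ^ 2 := by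
  obtain ⟨N, hN⟩ := exists_nat_gt (a + 1)
  obtain ⟨C, hC0, hC⟩ := h.exists_norm_normalizedBessel_mul_le ha N
  refine ⟨C * ∫ y : ℝ, ((1 + y) ^ N)⁻¹ ∂(omega a), mul_nonneg hC0 (integral_nonneg_of_ae
    (ae_omega_of_forall_pos a fun x hx => by rw [Pi.zero_apply]; positivity)), fun i ξ => ?_⟩
  refine (norm_integral_le_of_norm_le ((integrable_inv_one_add_pow ha hN).const_mul _)
    (ae_omega_of_forall_pos a (hC i ξ))).trans_eq ?_
  rw [integral_const_mul]
  ring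

lemma RadialChain.hasDerivAt_hankel (ha : -1 < a) (h : RadialChain RapidDecay 0 φ) (i : ι) (ξ : ℝ) :
    HasDerivAt (hankel a (φ i)) (ξ * -hankel (a + 2) (φ i) ξ) ξ := by
  have ha₂ : -1 < a + 2 := by linarith
  obtain ⟨N, hN⟩ := exists_nat_gt (a + 1)
  obtain ⟨C, hC0, hC⟩ := h.sq_mul.growth.exists_norm_normalizedBessel_mul_le ha₂ N
  have hbound : ∀ y, 0 < y → ∀ ζ ∈ Metric.ball ξ 1,
      ‖(ζ : ℂ) * -((normalizedBessel (a + 2) (ζ * y) : ℂ) * ((y : ℂ) ^ 2 * φ i y))‖ ≤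
        (|ξ| + 1) * (C * (1 + (|ξ| + 1)) ^ 2) * ((1 + y) ^ N)⁻¹ := fun y hy ζ hζ => by
    have hζ : |ζ| ≤ |ξ| + 1 := by
      linarith [abs_sub_abs_le_abs_sub ζ ξ, Real.dist_eq ζ ξ, Metric.mem_ball.1 hζ]
    rw [norm_mul, norm_neg, Complex.norm_real, mul_assoc (|ξ| + 1)]
    refine mul_le_mul hζ ((hC i ζ y hy).trans ?_) (norm_nonneg _) (by positivity)
    gcongr
  have hderiv : ∀ y ζ : ℝ, HasDerivAt (fun ζ => (normalizedBessel a (ζ * y) : ℂ) * φ i y)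
      (ζ * -((normalizedBessel (a + 2) (ζ * y) : ℂ) * ((y : ℂ) ^ 2 * φ i y))) ζ := fun y ζ => by
    refine (((hasDerivAt_normalizedBessel ha (ζ * y)).comp ζ
      ((hasDerivAt_id' ζ).mul_const y)).ofReal_comp.mul_const (φ i y)).congr_deriv ?_
    push_cast
    ring
  have hint := (integrable_normalizedBessel_mul ha ha₂ h.sq_mul i ξ).neg.const_mul (ξ : ℂ)
  have key := hasDerivAt_integral_of_dominated_loc_of_deriv_le
    (F := fun ζ y => (normalizedBessel a (ζ * y) : ℂ) * φ i y)
    (F' := fun ζ y => (ζ : ℂ) * -((normalizedBessel (a + 2) (ζ * y) : ℂ) * ((y : ℂ) ^ 2 * φ i y)))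
    (Metric.ball_mem_nhds ξ one_pos)
    (.of_forall fun ζ => (integrable_normalizedBessel_mul ha ha h i ζ).aestronglyMeasurable)
    (integrable_normalizedBessel_mul ha ha h i ξ) hint.aestronglyMeasurable
    (ae_omega_of_forall_pos a hbound) ((integrable_inv_one_add_pow ha hN).const_mul _)
    (.of_forall fun y ζ _ => hderiv y ζ)
  rw [integral_const_mul, integral_neg, ← hankel_add_two] at key
  exact key.2

lemma RadialChain.continuous_hankel (ha : -1 < a) [TopologicalSpace ι] [FirstCountableTopology ι]
    (h : RadialChain RapidDecay 0 φ) (hcont : ∀ y, 0 < y → Continuous fun i => φ i y) :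
    Continuous fun q : ℝ × ι => hankel a (φ q.2) q.1 := by
  obtain ⟨N, hN⟩ := exists_nat_gt (a + 1)
  obtain ⟨C, hC0, hC⟩ := h.growth.exists_norm_normalizedBessel_mul_le ha N
  refine continuous_iff_continuousAt.2 fun ⟨ξ, i⟩ => ?_
  have h_near : ∀ᶠ q : ℝ × ι in 𝓝 (ξ, i), |q.1| < |ξ| + 1 :=
    (show ContinuousAt (fun q : ℝ × ι => |q.1|) (ξ, i) by fun_prop).eventually_lt_const (by simp)
  refine continuousAt_of_dominated (bound := fun y => C * (1 + (|ξ| + 1)) ^ 2 * ((1 + y) ^ N)⁻¹)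
    (.of_forall fun q => (integrable_normalizedBessel_mul ha ha h q.2 q.1).aestronglyMeasurable)
    (h_near.mono fun q hq => ae_omega_of_forall_pos a fun y hy => (hC q.2 q.1 y hy).trans ?_)
    ((integrable_inv_one_add_pow ha hN).const_mul _) (ae_omega_of_forall_pos a fun y hy => ?_)
  · gcongr
  · have := continuous_normalizedBessel ha
    have := hcont y hy
    fun_prop

lemma RadialChain.hankel_sq_mul (ha : -1 < a) (h : RadialChain RapidDecay 0 φ) (i : ι) (ξ : ℝ) :
    hankel a (fun y => (y : ℂ) ^ 2 * φ i y) ξ =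
      (1 + a) * hankel (a + 2) (φ i) ξ - (ξ : ℂ) ^ 2 * hankel (a + 2 + 2) (φ i) ξ := by
  have hint₂ := integrable_normalizedBessel_mul ha (b := a + 2) (by linarith) h.sq_mul i ξ
  have hint₄ :=
    integrable_normalizedBessel_mul ha (b := a + 2 + 2) (by linarith) h.sq_mul.sq_mul i ξ
  have hshift : hankel (a + 2 + 2) (φ i) ξ = ∫ y : ℝ, (normalizedBessel (a + 2 + 2) (ξ * y) : ℂ) *
      ((y : ℂ) ^ 2 * ((y : ℂ) ^ 2 * φ i y)) ∂(omega a) := by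
    simp only [hankel_add_two (a + 2), integral_omega_add_two, mul_left_comm]
  rw [hshift, hankel_add_two, hankel, ← integral_const_mul, ← integral_const_mul,
    ← integral_sub (hint₂.const_mul _) (hint₄.const_mul _)]
  congr with y
  rw [normalizedBessel_recurrence ha]
  push_cast
  ring

lemma RadialChain.hankel_besselOp (ha : -1 < a) (h : RadialChain RapidDecay 2 φ) (i : ι) (ξ : ℝ) :
    hankel a (HalfLine.besselOp a (φ i)) ξ = -(ξ : ℂ) ^ 2 * hankel a (φ i) ξ := by
  have hgreen := integral_besselOp_mul ha h (radialChain_normalizedBessel ha ξ 1 2) i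
  simp only [one_mul] at hgreen
  rw [hankel, hankel, ← integral_const_mul]
  simp only [mul_comm (Complex.ofReal _)]
  rw [hgreen]
  refine integral_congr_ae (ae_omega_of_forall_pos a fun y hy => ?_)
  simp only [besselOp_normalizedBessel ha ξ hy]
  ring

lemma SchwartzFamily.hankel_iterate_besselOp (ha : -1 < a) (h : SchwartzFamily φ) (m : ℕ) (i : ι)
    (ξ : ℝ) : hankel a ((besselOp a)^[m] (φ i)) ξ = (-(ξ : ℂ) ^ 2) ^ m * hankel a (φ i) ξ := by
  induction m with
  | zero => simp
  | succ m ih =>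
    rw [Function.iterate_succ_apply', (h.iterate_besselOp a m 2).hankel_besselOp ha, ih]
    ring

lemma one_add_pow_le (m : ℕ) {x : ℝ} (hx : 0 < x) :
    (1 + x) ^ m ≤ 2 ^ m * (1 + (x ^ 2) ^ m) := by
  rcases le_total x 1 with hx1 | hx1
  · calc (1 + x) ^ m ≤ 2 ^ m * 1 := by
          rw [mul_one]
          gcongr
          linarith
      _ ≤ 2 ^ m * (1 + (x ^ 2) ^ m) := by
          gcongr
          linarith [show 0 ≤ (x ^ 2) ^ m by positivity]
  · calc (1 + x) ^ m ≤ (2 * x ^ 2) ^ m := by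
          gcongr
          nlinarith
      _ ≤ 2 ^ m * (1 + (x ^ 2) ^ m) := by
          rw [mul_pow]
          gcongr
          linarith

lemma SchwartzFamily.rapidDecay_hankel (ha : -1 < a) (h : SchwartzFamily φ) :
    RapidDecay fun i => hankel a (φ i) := fun m => by
  obtain ⟨C, -, hC⟩ := (h 0).growth.exists_norm_hankel_le ha
  obtain ⟨D, -, hD⟩ := (h.iterate_besselOp a (m + 2) 0).growth.exists_norm_hankel_le ha
  refine ⟨2 ^ (m + 2) * (C + D), fun i x hx => ?_⟩
  have hCx := hC i x
  have hDx := hD i x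
  rw [h.hankel_iterate_besselOp ha, norm_mul, norm_pow, norm_neg, norm_pow, Complex.norm_real,
    Real.norm_of_nonneg hx.le] at hDx
  rw [abs_of_pos hx] at hCx hDx
  rw [← div_eq_mul_inv, le_div_iff₀ (by positivity)]
  refine le_of_mul_le_mul_right ?_ (show 0 < (1 + x) ^ 2 by positivity)
  calc ‖hankel a (φ i) x‖ * (1 + x) ^ m * (1 + x) ^ 2
    _ = (1 + x) ^ (m + 2) * ‖hankel a (φ i) x‖ := by ring
    _ ≤ 2 ^ (m + 2) * (1 + (x ^ 2) ^ (m + 2)) * ‖hankel a (φ i) x‖ := by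
      gcongr
      exact one_add_pow_le _ hx
    _ = 2 ^ (m + 2) * (‖hankel a (φ i) x‖ + (x ^ 2) ^ (m + 2) * ‖hankel a (φ i) x‖) := by ring
    _ ≤ 2 ^ (m + 2) * (C * (1 + x) ^ 2 + D * (1 + x) ^ 2) := by gcongr
    _ = 2 ^ (m + 2) * (C + D) * (1 + x) ^ 2 := by ring

theorem SchwartzFamily.hankel (ha : -1 < a) (h : SchwartzFamily φ) :
    SchwartzFamily fun i => hankel a (φ i) := fun n => by
  induction n generalizing a with
  | zero => exact ⟨h.rapidDecay_hankel ha, fun i x _ =>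
      ((h 0).hasDerivAt_hankel ha i x).continuousAt.continuousWithinAt⟩
  | succ n ih => exact ⟨h.rapidDecay_hankel ha, _, (ih (a := a + 2) (by linarith)).const_mul (-1),
      fun i x _ => by simpa using (h 0).hasDerivAt_hankel ha i x⟩

lemma RadialChain.integrable_prod_normalizedBessel_mul (ha : -1 < a)
    (hφ : RadialChain RapidDecay 0 φ) {ψ : ι → ℝ → ℂ} (hψ : RadialChain RapidDecay 0 ψ) (i : ι)
    (r : ℝ) :
    Integrable (fun q : ℝ × ℝ => (normalizedBessel a (r * q.1 * q.2) : ℂ) * φ i q.2 * ψ i q.1)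
      ((omega a).prod (omega a)) := by
  obtain ⟨N, hN⟩ := exists_nat_gt (a + 1)
  obtain ⟨C, hC0, hC⟩ := hφ.growth.exists_norm_normalizedBessel_mul_le ha N
  obtain ⟨D, hD⟩ := hψ.growth (N + 2)
  have h_int := integrable_inv_one_add_pow ha hN
  have h_meas : AEStronglyMeasurable (fun q : ℝ × ℝ => (normalizedBessel a (r * q.1 * q.2) : ℂ))
      ((omega a).prod (omega a)) := by
    have := continuous_normalizedBessel ha
    exact (by fun_prop : Continuous _).aestronglyMeasurable
  have h_pos : ∀ᵐ x ∂(omega a), 0 < x := ae_omega_of_forall_pos a fun _ hx => hx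
  refine ((h_int.const_mul (C * (1 + |r|) ^ 2 * D)).mul_prod h_int).mono'
    ((h_meas.mul (hφ.integrable ha i).aestronglyMeasurable.comp_snd).mul
      (hψ.integrable ha i).aestronglyMeasurable.comp_fst) ?_
  filter_upwards [Measure.quasiMeasurePreserving_fst.ae h_pos,
    Measure.quasiMeasurePreserving_snd.ae h_pos] with q hq₁ hq₂
  calc ‖(normalizedBessel a (r * q.1 * q.2) : ℂ) * φ i q.2 * ψ i q.1‖
    _ ≤ C * (1 + |r * q.1|) ^ 2 * ((1 + q.2) ^ N)⁻¹ * (D * ((1 + q.1) ^ (N + 2))⁻¹) := by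
      rw [norm_mul]
      gcongr
      exacts [hC i _ _ hq₂, hD i _ hq₁]
    _ ≤ C * ((1 + |r|) * (1 + q.1)) ^ 2 * ((1 + q.2) ^ N)⁻¹ * (D * ((1 + q.1) ^ (N + 2))⁻¹) := by
      have hD0 := (norm_nonneg _).trans (hD i _ hq₁)
      gcongr
      rw [abs_mul, abs_of_pos hq₁]
      nlinarith [abs_nonneg r]
    _ = C * (1 + |r|) ^ 2 * D * ((1 + q.1) ^ N)⁻¹ * ((1 + q.2) ^ N)⁻¹ := by
      rw [pow_add]
      field_simp

theorem integral_hankel_mul (ha : -1 < a) {φ ψ : ι → ℝ → ℂ} (hφ : RadialChain RapidDecay 0 φ)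
    (hψ : RadialChain RapidDecay 0 ψ) (i : ι) (r : ℝ) :
    ∫ x, hankel a (φ i) (r * x) * ψ i x ∂(omega a) =
      ∫ x, φ i x * hankel a (ψ i) (r * x) ∂(omega a) := by
  simp only [HalfLine.hankel, ← integral_const_mul, ← integral_mul_const]
  rw [integral_integral_swap (hφ.integrable_prod_normalizedBessel_mul ha hψ i r)]
  congr with y
  congr with x
  rw [mul_right_comm r x y]
  ring

end Hankel

/-! ### Gaussians -/

section Gauss

variable {a : ℝ} {z : ℂ}

/-- The Gaussian `exp (-z y ^ 2)` with complex parameter `z`. -/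
def gauss (z : ℂ) (y : ℝ) : ℂ := Complex.exp (-z * (y : ℂ) ^ 2)

lemma gauss_mul_gauss (z w : ℂ) (y : ℝ) : gauss z y * gauss w y = gauss (z + w) y := by
  rw [gauss, gauss, gauss, ← Complex.exp_add]
  ring_nf

lemma norm_gauss (z : ℂ) (y : ℝ) : ‖gauss z y‖ = Real.exp (-z.re * y ^ 2) := by
  rw [gauss, Complex.norm_exp, ← Complex.ofReal_pow, Complex.re_mul_ofReal, Complex.neg_re]

lemma continuous_gauss (z : ℂ) : Continuous (gauss z) := by
  unfold gauss
  fun_prop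

lemma hasRadialDeriv_gauss (z : ℂ) : HasRadialDeriv (gauss z) fun y => -2 * z * gauss z y :=
  fun y hy => (hasRadialDeriv_cexp_mul_sq (-z) y hy).congr_deriv (by simp only [gauss]; ring)

lemma rapidDecay_mul_gauss (hz : 0 < z.re) (c : ℂ) :
    RapidDecay fun _ : Unit => (c * gauss z ·) := by
  refine fun m => ⟨‖c‖ * (2 ^ m * (1 + m.factorial / z.re ^ m)), fun _ x hx => ?_⟩
  have hexp := Real.pow_div_factorial_le_exp (z.re * x ^ 2) (by positivity) m
  rw [div_le_iff₀ (by positivity), mul_pow] at hexp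
  have hone : 1 ≤ Real.exp (z.re * x ^ 2) := Real.one_le_exp (by positivity)
  rw [norm_mul, norm_gauss, neg_mul, Real.exp_neg, mul_assoc]
  gcongr
  rw [← div_eq_mul_inv, le_div_iff₀ (by positivity), inv_mul_le_iff₀ (by positivity)]
  calc (1 + x) ^ m ≤ 2 ^ m * (1 + (x ^ 2) ^ m) := one_add_pow_le m hx
    _ ≤ 2 ^ m * (Real.exp (z.re * x ^ 2) + Real.exp (z.re * x ^ 2) * m.factorial / z.re ^ m) := by
      gcongr
      rw [le_div_iff₀ (by positivity)]
      linarith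
    _ = Real.exp (z.re * x ^ 2) * (2 ^ m * (1 + m.factorial / z.re ^ m)) := by ring

lemma schwartzFamily_mul_gauss (hz : 0 < z.re) (c : ℂ) :
    SchwartzFamily fun _ : Unit => (c * gauss z ·) := fun n => by
  induction n generalizing c with
  | zero => exact ⟨rapidDecay_mul_gauss hz c, fun _ => by have := continuous_gauss z; fun_prop⟩
  | succ n ih => exact ⟨rapidDecay_mul_gauss hz c, _, ih (c * (-2 * z)), fun _ x hx =>
      ((hasRadialDeriv_gauss z x hx).const_mul c).congr_deriv (by ring)⟩

lemma schwartzFamily_gauss (hz : 0 < z.re) : SchwartzFamily fun _ : Unit => gauss z := by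
  simpa only [one_mul] using schwartzFamily_mul_gauss hz 1

lemma hankel_gauss_eq_mul_hankel_add_two (ha : -1 < a) (hz : 0 < z.re) (ξ : ℝ) :
    hankel a (gauss z) ξ = 2 * z * hankel (a + 2) (gauss z) ξ := by
  have ha₂ : -1 < a + 2 := by linarith
  have hg := schwartzFamily_gauss hz
  have hE (b : ℝ) (hb : -1 < b) (c : ℂ) := radialChain_normalizedBessel (ι := Unit) hb ξ c 0
  have key := integral_sq_mul_add_eq_zero ha ((hg 0).mul (hE _ ha₂ 1)).growth
    (((schwartzFamily_mul_gauss hz (-2 * z) 0).mul (hE _ ha₂ 1)).add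
      ((hg 0).mul (hE (a + 2 + 2) (by linarith) (-(ξ : ℂ) ^ 2))))
    (fun _ y hy => ((hasRadialDeriv_gauss z y hy).mul
      ((hasRadialDeriv_normalizedBessel ha₂ ξ y hy).const_mul 1)).congr_deriv (by ring)) ()
  rw [← sub_eq_zero, ← key, hankel_add_two, hankel, ← integral_const_mul,
    ← integral_sub (integrable_normalizedBessel_mul ha ha (hg 0) () ξ)
      ((integrable_normalizedBessel_mul ha ha₂ (hg 0).sq_mul () ξ).const_mul _)]
  congr with y
  rw [normalizedBessel_recurrence ha]
  push_cast
  ring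

lemma integral_gauss_add_two (ha : -1 < a) (hz : 0 < z.re) :
    2 * z * ∫ y, gauss z y ∂(omega (a + 2)) = (1 + a) * ∫ y, gauss z y ∂(omega a) := by
  have hg := schwartzFamily_gauss hz 0
  have key := integral_sq_mul_add_eq_zero ha hg.growth (schwartzFamily_mul_gauss hz (-2 * z) 0)
    (fun _ => hasRadialDeriv_gauss z) ()
  rw [integral_omega_add_two, ← integral_const_mul, ← integral_const_mul, eq_comm, ← sub_eq_zero,
    ← integral_sub ((hg.integrable ha ()).const_mul _) ((hg.sq_mul.integrable ha ()).const_mul _),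
    ← key]
  congr with y
  ring

lemma hasDerivAt_integral_gauss (ha : -1 < a) (hz : 0 < z.re) :
    HasDerivAt (fun z => ∫ y, gauss z y ∂(omega a)) (-∫ y, gauss z y ∂(omega (a + 2))) z := by
  have hz₂ : 0 < ((z.re / 2 : ℝ) : ℂ).re := by simpa using hz
  have hmeas (z : ℂ) : AEStronglyMeasurable (fun y : ℝ => (y : ℂ) ^ 2 * gauss z y) (omega a) :=
    (by have := continuous_gauss z; fun_prop : Continuous _).aestronglyMeasurable
  have hderiv (y : ℝ) (ζ : ℂ) : HasDerivAt (gauss · y) (-((y : ℂ) ^ 2 * gauss ζ y)) ζ :=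
    ((hasDerivAt_neg' ζ).mul_const ((y : ℂ) ^ 2)).cexp.congr_deriv (by rw [gauss]; ring)
  have key := hasDerivAt_integral_of_dominated_loc_of_deriv_le (𝕜 := ℂ) (μ := omega a)
    (F := gauss) (F' := fun z y => -((y : ℂ) ^ 2 * gauss z y))
    (bound := fun y => ‖(y : ℂ) ^ 2 * gauss ((z.re / 2 : ℝ) : ℂ) y‖)
    (Metric.ball_mem_nhds z (half_pos hz))
    (.of_forall fun ζ => (continuous_gauss ζ).aestronglyMeasurable)
    ((schwartzFamily_gauss hz 0).integrable ha ()) (hmeas z).neg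
    (.of_forall fun y ζ hζ => ?_) (((schwartzFamily_gauss hz₂ 0).sq_mul.integrable ha ()).norm)
    (.of_forall fun y ζ _ => hderiv y ζ)
  · rw [integral_neg, ← integral_omega_add_two] at key
    exact key.2
  · have hre : z.re / 2 ≤ ζ.re := by
      have := (abs_lt.1 ((Complex.abs_re_le_norm (ζ - z)).trans_lt (mem_ball_iff_norm.1 hζ))).1
      rw [Complex.sub_re] at this
      linarith
    rw [norm_neg, norm_mul, norm_mul, norm_gauss, norm_gauss, Complex.ofReal_re]
    gcongr

lemma integral_gauss (ha : -1 < a) (hz : 0 < z.re) : ∫ y, gauss z y ∂(omega a) =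
    Real.Gamma ((a + 1) / 2) / 2 * z ^ (-(((a + 1) / 2 : ℝ) : ℂ)) := by
  set s : ℂ := (((a + 1) / 2 : ℝ) : ℂ) with hs
  have hderiv : ∀ z : ℂ, 0 < z.re →
      HasDerivAt (fun z => z ^ s * ∫ y, gauss z y ∂(omega a)) 0 z := fun z hz => by
    have hz0 : z ≠ 0 := fun h => by simp [h] at hz
    have hrec := integral_gauss_add_two ha hz
    rw [show (1 + a : ℂ) = 2 * s by rw [hs]; push_cast; ring] at hrec
    refine (((hasDerivAt_id' z).cpow_const (Or.inl hz)).mul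
      (hasDerivAt_integral_gauss ha hz)).congr_deriv ?_
    rw [← sub_add_cancel s 1, Complex.cpow_add _ _ hz0, Complex.cpow_one, sub_add_cancel]
    linear_combination -(z ^ (s - 1)) / 2 * hrec
  have hconst : z ^ s * ∫ y, gauss z y ∂(omega a) = 1 ^ s * ∫ y, gauss 1 y ∂(omega a) :=
    (isOpen_lt continuous_const Complex.continuous_re).is_const_of_deriv_eq_zero
      (convex_halfSpace_re_gt 0).isPreconnected
      (fun z hz => (hderiv z hz).differentiableAt.differentiableWithinAt)
      (fun z hz => (hderiv z hz).deriv) hz (show (0 : ℝ) < (1 : ℂ).re by simp)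
  have hone : ∫ y, gauss 1 y ∂(omega a) = Real.Gamma ((a + 1) / 2) / 2 := by
    have hΓ := integral_rpow_mul_exp_neg_rpow two_pos ha
    rw [one_div_mul_eq_div] at hΓ
    rw [integral_omega, ← Complex.ofReal_ofNat, ← Complex.ofReal_div, ← hΓ,
      ← integral_complex_ofReal]
    congr with x
    simp [gauss]
  have hz0 : z ^ s ≠ 0 := by
    rw [Complex.cpow_ne_zero_iff]
    exact Or.inl fun h => by simp [h] at hz
  rw [Complex.one_cpow, one_mul, hone] at hconst
  rw [Complex.cpow_neg, ← hconst]
  field_simp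

lemma hankel_gauss_zero (ha : -1 < a) (hz : 0 < z.re) : hankel a (gauss z) 0 =
    ((2 ^ (-((a + 1) / 2)) : ℝ) : ℂ) * z ^ (-(((a + 1) / 2 : ℝ) : ℂ)) := by
  have hE : normalizedBessel a 0 = 2 ^ ((1 - a) / 2) / Real.Gamma ((a + 1) / 2) := by
    simp [normalizedBessel_eq_zero_add ha, besselCoeff, div_eq_mul_inv, mul_comm]
  have hΓ : (Real.Gamma ((a + 1) / 2) : ℂ) ≠ 0 :=
    Complex.ofReal_ne_zero.2 (Real.Gamma_pos_of_pos (by linarith)).ne'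
  have hpow : (2 : ℝ) ^ ((1 - a) / 2) = 2 ^ (-((a + 1) / 2)) * 2 := by
    rw [← Real.rpow_add_one two_ne_zero]
    ring_nf
  simp only [hankel, zero_mul, hE, hpow]
  rw [integral_const_mul, integral_gauss ha hz, ← mul_assoc]
  congr 1
  push_cast
  field_simp

theorem hankel_gauss (ha : -1 < a) (hz : 0 < z.re) (ξ : ℝ) :
    hankel a (gauss z) ξ = ((2 ^ (-((a + 1) / 2)) : ℝ) : ℂ) * z ^ (-(((a + 1) / 2 : ℝ) : ℂ)) *
      gauss (1 / (4 * z)) ξ := by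
  have hz0 : z ≠ 0 := fun h => by simp [h] at hz
  have hderiv (ξ : ℝ) :
      HasDerivAt (fun ξ => hankel a (gauss z) ξ * gauss (-(1 / (4 * z))) ξ) 0 ξ := by
    refine (((schwartzFamily_gauss hz 0).hasDerivAt_hankel ha () ξ).mul
      ((hasDerivAt_id' ξ).ofReal_comp.fun_pow 2 |>.const_mul _).cexp).congr_deriv ?_
    rw [hankel_gauss_eq_mul_hankel_add_two ha hz]
    push_cast
    field_simp
    ring
  have hconst := is_const_of_deriv_eq_zero (fun ξ => (hderiv ξ).differentiableAt)
    (fun ξ => (hderiv ξ).deriv) ξ 0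
  have hcancel : gauss (-(1 / (4 * z))) ξ * gauss (1 / (4 * z)) ξ = 1 := by
    rw [gauss_mul_gauss, neg_add_cancel, gauss, neg_zero, zero_mul, Complex.exp_zero]
  calc hankel a (gauss z) ξ
    _ = hankel a (gauss z) ξ * gauss (-(1 / (4 * z))) ξ * gauss (1 / (4 * z)) ξ := by
      rw [mul_assoc, hcancel, mul_one]
    _ = _ := by
      rw [hconst, hankel_gauss_zero ha hz]
      simp [gauss]

end Gauss

/-! ### Completeness of the Gaussians and Hankel inversion -/

section Inversion

variable {a : ℝ} {f g : ℝ → ℂ}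

lemma rpow_smul_rpow_smul_sqrt (a : ℝ) (f : ℝ → ℂ) {x : ℝ} (hx : 0 < x) :
    x ^ ((2 : ℝ) - 1) • ((x ^ (2 : ℝ)) ^ ((a - 1) / 2) • f √(x ^ (2 : ℝ))) = x ^ a • f x := by
  rw [smul_smul, ← Real.rpow_mul hx.le, ← Real.rpow_add hx, Real.rpow_ofNat, Real.sqrt_sq hx.le]
  ring_nf

lemma integrableOn_rpow_smul_comp_sqrt (hf : Integrable f (omega a)) :
    IntegrableOn (fun s => s ^ ((a - 1) / 2) • f √s) (Ioi 0) :=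
  (integrableOn_Ioi_comp_rpow_iff' _ two_ne_zero).1
    ((integrableOn_congr_fun (fun _ => rpow_smul_rpow_smul_sqrt a f) measurableSet_Ioi).2
      (integrable_omega_iff.1 hf))

lemma integral_rpow_smul_comp_sqrt (a : ℝ) (f : ℝ → ℂ) :
    ∫ s in Ioi 0, s ^ ((a - 1) / 2) • f √s = 2 * ∫ x, f x ∂(omega a) := by
  rw [← integral_comp_rpow_Ioi_of_pos two_pos, integral_omega, ← integral_const_mul]
  refine setIntegral_congr_fun measurableSet_Ioi fun x hx => ?_
  rw [mul_smul, rpow_smul_rpow_smul_sqrt a f hx, two_smul, two_mul]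

/-- In the variable `s = x ^ 2`, the pairings of `f` with the Gaussians of parameter `1 + 2πi w` are
the Fourier transform of an integrable function. -/
lemma fourier_indicator_rpow_smul_comp_sqrt (a : ℝ) (f : ℝ → ℂ) (w : ℝ) :
    FourierTransform.fourier
        ((Ioi 0).indicator fun s => s ^ ((a - 1) / 2) • (f √s * gauss 1 √s)) w =
      2 * ∫ x, f x * gauss (1 + 2 * Real.pi * w * Complex.I) x ∂(omega a) := by
  set F : ℝ → ℂ := (Ioi 0).indicator fun s => s ^ ((a - 1) / 2) • (f √s * gauss 1 √s) with hF
  have hchar : ∀ s ∈ Ioi (0 : ℝ), Complex.exp (((-2 * Real.pi * s * w : ℝ) : ℂ) * Complex.I) =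
      gauss (2 * Real.pi * w * Complex.I) √s := fun s hs => by
    have hsqrt : (√s : ℂ) ^ 2 = s := by
      rw [← Complex.ofReal_pow, Real.sq_sqrt (le_of_lt (mem_Ioi.1 hs))]
    simp only [gauss, hsqrt]
    push_cast
    ring_nf
  have hintegrand : ∀ s ∈ Ioi (0 : ℝ),
      Complex.exp (((-2 * Real.pi * s * w : ℝ) : ℂ) * Complex.I) • F s =
        s ^ ((a - 1) / 2) • (f √s * gauss (1 + 2 * Real.pi * w * Complex.I) √s) := fun s hs => by
    rw [hF, indicator_of_mem hs, ← gauss_mul_gauss, hchar s hs, smul_comm, smul_eq_mul,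
      mul_left_comm, mul_comm (gauss 1 _)]
  rw [Real.fourier_real_eq_integral_exp_smul,
    ← setIntegral_eq_integral_of_forall_compl_eq_zero (s := Ioi 0) fun s hs => by
      rw [hF, indicator_of_notMem hs, smul_zero],
    setIntegral_congr_fun measurableSet_Ioi hintegrand, integral_rpow_smul_comp_sqrt a fun x =>
      f x * gauss (1 + 2 * Real.pi * w * Complex.I) x]

lemma eqOn_zero_of_integral_mul_gauss_eq_zero (hf : ContinuousOn f (Ioi 0))
    (hi : Integrable (fun x => f x * gauss 1 x) (omega a))
    (h : ∀ z : ℂ, 0 < z.re → ∫ x, f x * gauss z x ∂(omega a) = 0) : EqOn f 0 (Ioi 0) := by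
  set F : ℝ → ℂ := (Ioi 0).indicator fun s => s ^ ((a - 1) / 2) • (f √s * gauss 1 √s) with hF
  have hF_int : Integrable F :=
    (integrable_indicator_iff measurableSet_Ioi).2 (integrableOn_rpow_smul_comp_sqrt hi)
  have hF_fourier : FourierTransform.fourier F = 0 := funext fun w => by
    rw [hF, fourier_indicator_rpow_smul_comp_sqrt, h _ (by simp), mul_zero, Pi.zero_apply]
  intro x hx
  have hx2 : 0 < x ^ 2 := by have : 0 < x := hx; positivity
  have hcont : ContinuousAt F (x ^ 2) := by
    refine ContinuousAt.congr ?_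
      ((eqOn_indicator (s := Ioi (0 : ℝ))).symm.eventuallyEq_of_mem (Ioi_mem_nhds hx2))
    have hf_cont : ContinuousAt (fun s => f √s) (x ^ 2) :=
      (hf.continuousAt (Ioi_mem_nhds (Real.sqrt_pos.2 hx2))).comp Real.continuous_sqrt.continuousAt
    exact (Real.continuousAt_rpow_const _ _ (.inl hx2.ne')).smul
      (hf_cont.mul ((continuous_gauss 1).comp Real.continuous_sqrt).continuousAt)
  have hF_zero : F (x ^ 2) = 0 := by
    rw [← hF_int.fourierInv_fourier_eq (by rw [hF_fourier]; exact integrable_zero ..) hcont,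
      hF_fourier]
    simp [Real.fourierInv_eq]
  rw [hF, indicator_of_mem (mem_Ioi.2 hx2), Real.sqrt_sq (le_of_lt hx), smul_eq_zero,
    mul_eq_zero] at hF_zero
  exact (hF_zero.resolve_left (Real.rpow_pos_of_pos hx2 _).ne').resolve_right
    (Complex.exp_ne_zero _)

lemma eqOn_of_integral_mul_gauss_eq (ha : -1 < a)
    (hf : RadialChain PolyGrowth 0 fun _ : Unit => f)
    (hg : RadialChain PolyGrowth 0 fun _ : Unit => g)
    (h : ∀ z : ℂ, 0 < z.re →
      ∫ x, f x * gauss z x ∂(omega a) = ∫ x, g x * gauss z x ∂(omega a)) :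
    EqOn f g (Ioi 0) := by
  have hint {φ : ℝ → ℂ} (hφ : RadialChain PolyGrowth 0 fun _ : Unit => φ) {z : ℂ} (hz : 0 < z.re) :
      Integrable (fun x => φ x * gauss z x) (omega a) := by
    simpa only [mul_comm] using ((schwartzFamily_gauss hz 0).mul hφ).integrable ha ()
  have hone : 0 < (1 : ℂ).re := by simp
  have key := eqOn_zero_of_integral_mul_gauss_eq_zero (a := a) (f := fun x => f x - g x)
    ((hf.2 ()).sub (hg.2 ()))
    (((hint hf hone).sub (hint hg hone)).congr (.of_forall fun x => (sub_mul ..).symm))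
    fun z hz => by
      simp only [sub_mul]
      rw [integral_sub (hint hf hz) (hint hg hz), h z hz, sub_self]
  exact fun x hx => sub_eq_zero.1 (key hx)

lemma RadialChain.polyGrowth {ι : Type*} {φ : ι → ℝ → ℂ} (h : RadialChain RapidDecay 0 φ) :
    RadialChain PolyGrowth 0 φ := by
  obtain ⟨C, hC⟩ := h.1 0
  exact ⟨⟨0, C, by simpa using hC⟩, h.2⟩

lemma hankel_const_mul (a : ℝ) (c : ℂ) (f : ℝ → ℂ) (ξ : ℝ) :
    hankel a (fun y => c * f y) ξ = c * hankel a f ξ := by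
  simp only [hankel, mul_left_comm _ c, integral_const_mul]

lemma mul_cpow_of_re_nonneg {z w : ℂ} (hz0 : z ≠ 0) (hz : 0 ≤ z.re) (hw : 0 < w.re) (r : ℂ) :
    (z * w) ^ r = z ^ r * w ^ r := by
  have hw0 : w ≠ 0 := fun h => by simp [h] at hw
  have hz_arg := abs_le.1 (Complex.abs_arg_le_pi_div_two_iff.2 hz)
  have hw_arg := abs_lt.1 (Complex.abs_arg_lt_pi_div_two_iff.2 (Or.inl hw))
  rw [Complex.cpow_def_of_ne_zero (mul_ne_zero hz0 hw0), Complex.cpow_def_of_ne_zero hz0,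
    Complex.cpow_def_of_ne_zero hw0, ← Complex.exp_add, ← add_mul,
    Complex.log_mul hz0 hw0 ⟨by linarith, by linarith⟩]

lemma hankel_gauss_mul_hankel_gauss (ha : -1 < a) {c z : ℂ} (hc : 0 ≤ c.re) (hz : 0 < z.re)
    (x : ℝ) : hankel a (fun ξ => gauss c ξ * hankel a (gauss z) ξ) x =
      (1 + 4 * c * z) ^ (-(((a + 1) / 2 : ℝ) : ℂ)) * gauss (z / (1 + 4 * c * z)) x := by
  have hz0 : z ≠ 0 := fun h => by simp [h] at hz
  have hre : 0 < (c + 1 / (4 * z)).re := by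
    have hinv : 0 < (1 / (4 * z)).re := by
      rw [one_div, Complex.inv_re]
      exact div_pos (by simpa using hz) (Complex.normSq_pos.2 (by simp [hz0]))
    rw [Complex.add_re]
    linarith
  have hfun : (fun ξ => gauss c ξ * hankel a (gauss z) ξ) = fun ξ =>
      ((2 ^ (-((a + 1) / 2)) : ℝ) : ℂ) * z ^ (-(((a + 1) / 2 : ℝ) : ℂ)) *
        gauss (c + 1 / (4 * z)) ξ := funext fun ξ => by
    rw [hankel_gauss ha hz, ← gauss_mul_gauss]
    ring
  have hprod : 1 + 4 * c * z = 2 * 2 * z * (c + 1 / (4 * z)) := by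
    field_simp
    ring
  have hdiv : z / (1 + 4 * c * z) = 1 / (4 * (c + 1 / (4 * z))) := by
    rw [hprod]
    field_simp
    norm_num
  have hpow : (2 * 2 * z * (c + 1 / (4 * z))) ^ (-(((a + 1) / 2 : ℝ) : ℂ)) =
      ((2 ^ (-((a + 1) / 2)) : ℝ) : ℂ) * ((2 ^ (-((a + 1) / 2)) : ℝ) : ℂ) *
        z ^ (-(((a + 1) / 2 : ℝ) : ℂ)) * (c + 1 / (4 * z)) ^ (-(((a + 1) / 2 : ℝ) : ℂ)) := by
    rw [mul_cpow_of_re_nonneg (by simp [hz0]) (by simp [hz.le]) hre, mul_assoc 2 2 z,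
      mul_cpow_of_re_nonneg two_ne_zero (by simp) (by simp [hz]),
      mul_cpow_of_re_nonneg two_ne_zero (by simp) hz, Complex.ofReal_cpow zero_le_two]
    push_cast
    ring
  rw [hfun, hankel_const_mul, hankel_gauss ha hre, hdiv, hprod, hpow]
  ring

theorem SchwartzFamily.hankel_hankel {ι : Type*} {φ : ι → ℝ → ℂ} (ha : -1 < a)
    (h : SchwartzFamily φ) (i : ι) :
    EqOn (HalfLine.hankel a (HalfLine.hankel a (φ i))) (φ i) (Ioi 0) := by
  have hφ := h.comp fun _ : Unit => i
  refine eqOn_of_integral_mul_gauss_eq ha ((hφ.hankel ha).hankel ha 0).polyGrowth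
    (hφ 0).polyGrowth fun z hz => ?_
  have hz' := schwartzFamily_gauss hz
  have h₁ := integral_hankel_mul ha (hφ.hankel ha 0) (hz' 0) () 1
  have h₂ := integral_hankel_mul ha (hφ 0) (hz'.hankel ha 0) () 1
  simp only [one_mul] at h₁ h₂
  rw [h₁, h₂]
  congr with y
  have := hankel_gauss_mul_hankel_gauss ha (c := 0) le_rfl hz y
  simp_all [gauss]

end Inversion

/-! ### The free evolution and its kernel -/

section Kernel

variable {a t x y : ℝ} {f : ℝ → ℂ} {ι : Type*} {φ : ι → ℝ → ℂ}

lemma SchwartzFamily.gauss_mul {c : ι → ℂ} {M : ℝ} (h : SchwartzFamily φ) (hc : ∀ i, ‖c i‖ ≤ M)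
    (hre : ∀ i, 0 ≤ (c i).re) : SchwartzFamily fun i x => gauss (c i) x * φ i x := fun n => by
  simpa only [gauss, one_mul, mul_comm] using (h n).mul (radialChain_mul_cexp (c := fun i => -c i)
    (k := fun _ => 1) (fun i => (norm_neg (c i)).trans_le (hc i)) (by simpa using hre)
    (fun _ => le_rfl) n)

lemma gauss_mul_left (z : ℂ) (r x : ℝ) : gauss z (r * x) = gauss ((r : ℂ) ^ 2 * z) x := by
  simp only [gauss]
  push_cast
  ring_nf

/-- The free evolution `e ^ {it ℬ_a} f`, computed on the Hankel side. -/
def freeEvolution (a t : ℝ) (f : ℝ → ℂ) : ℝ → ℂ :=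
  hankel a fun ξ => gauss (Complex.I * t) ξ * hankel a f ξ

/-- The operator with kernel `S_a(x, y, t)`, written as a Hankel transform between two
multiplications by the chirp `x ↦ e ^ {ix² / (4t)}`. -/
def chirpHankel (a t : ℝ) (f : ℝ → ℂ) (x : ℝ) : ℂ :=
  (2 * (Complex.I * t)) ^ (-(((a + 1) / 2 : ℝ) : ℂ)) * (gauss (1 / (4 * (Complex.I * t))) x *
    hankel a (fun y => gauss (1 / (4 * (Complex.I * t))) y * f y) (1 / (2 * t) * x))

lemma re_one_div_four_mul_I_mul (t : ℝ) : (1 / (4 * (Complex.I * t))).re = 0 := by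
  rw [one_div, Complex.inv_re]
  simp

lemma two_mul_I_mul_cpow_neg (s : ℝ) (ht : t ≠ 0) : (2 * (Complex.I * t)) ^ (-(s : ℂ)) =
    Complex.exp (-(SignType.sign t * (Complex.I * ((s * Real.pi / 2 : ℝ) : ℂ)))) /
      (((2 * |t|) ^ s : ℝ) : ℂ) := by
  have hpos : 0 < 2 * |t| := by positivity
  have hprod : 2 * (Complex.I * t) = ((2 * |t| : ℝ) : ℂ) * (SignType.sign t * Complex.I) := by
    rcases ht.lt_or_gt with h | h
    · simp [h, abs_of_neg]; ring
    · simp [h, abs_of_pos]; ring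
  have hlog : Complex.log (SignType.sign t * Complex.I) =
      SignType.sign t * (Real.pi / 2 * Complex.I) := by
    rcases ht.lt_or_gt with h | h
    · simp [h, Complex.log_neg_I]
    · simp [h, Complex.log_I]
  have hne : (SignType.sign t * Complex.I : ℂ) ≠ 0 := by
    rcases ht.lt_or_gt with h | h <;> simp [h]
  rw [hprod, Complex.cpow_def_of_ne_zero (mul_ne_zero (by exact_mod_cast hpos.ne') hne),
    Complex.log_ofReal_mul hpos hne, hlog, Real.rpow_def_of_pos hpos, Complex.ofReal_exp,
    ← Complex.exp_sub]
  push_cast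
  ring_nf

lemma kernelS_eq (hx : 0 < x) (hy : 0 < y) (ht : t ≠ 0) : kernelS a x y t =
    (2 * (Complex.I * t)) ^ (-(((a + 1) / 2 : ℝ) : ℂ)) * (gauss (1 / (4 * (Complex.I * t))) x *
      ((normalizedBessel a (1 / (2 * t) * x * y) : ℂ) * gauss (1 / (4 * (Complex.I * t))) y)) := by
  have hpos : 0 < x * y / (2 * |t|) := by positivity
  have hgauss : gauss (1 / (4 * (Complex.I * t))) x * gauss (1 / (4 * (Complex.I * t))) y =
      Complex.exp (Complex.I * (((x ^ 2 + y ^ 2) / (4 * t) : ℝ) : ℂ)) := by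
    simp only [gauss, ← Complex.exp_add]
    have ht' : (t : ℂ) ≠ 0 := by exact_mod_cast ht
    push_cast
    congr 1
    field_simp
    linear_combination (-(x : ℂ) ^ 2 - y ^ 2) * Complex.I_sq
  have hbessel : (x * y / (2 * |t|)) ^ ((1 - a) / 2) * besselJ ((a - 1) / 2) (x * y / (2 * |t|)) =
      normalizedBessel a (1 / (2 * t) * x * y) := by
    rw [rpow_mul_besselJ hpos]
    rcases ht.lt_or_gt with h | h
    · rw [abs_of_neg h, ← normalizedBessel_neg]
      ring_nf
    · rw [abs_of_pos h]
      ring_nf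
  rw [mul_left_comm (gauss _ x), hgauss, two_mul_I_mul_cpow_neg _ ht, kernelS, hbessel,
    mul_comm (normalizedBessel _ _ : ℂ), ← mul_assoc, mul_right_comm]
  rcases ht.lt_or_gt with h | h
  · rw [if_pos h, sign_neg h, abs_of_neg h, SignType.coe_neg_one]
    push_cast
    ring_nf
  · rw [if_neg h.not_gt, if_pos h, sign_pos h, abs_of_pos h, SignType.coe_one]
    push_cast
    ring_nf

lemma SchwartzFamily.gauss_mul_single (h : SchwartzFamily fun _ : Unit => f) {c : ℂ}
    (hc : 0 ≤ c.re) : SchwartzFamily fun _ : Unit => fun x => gauss c x * f x :=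
  h.gauss_mul (c := fun _ => c) (fun _ => le_rfl) fun _ => hc

lemma SchwartzFamily.freeEvolution (ha : -1 < a) (h : SchwartzFamily fun _ : Unit => f) (t : ℝ) :
    SchwartzFamily fun _ : Unit => freeEvolution a t f :=
  ((h.hankel ha).gauss_mul_single (by simp)).hankel ha

lemma integrable_kernelS_mul (ha : -1 < a) (h : SchwartzFamily fun _ : Unit => f) (hx : 0 < x)
    (ht : t ≠ 0) : Integrable (fun y => kernelS a x y t * f y) (omega a) := by
  have hf := h.gauss_mul_single (re_one_div_four_mul_I_mul t).ge
  refine ((integrable_normalizedBessel_mul ha ha (hf 0) () (1 / (2 * t) * x)).const_mul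
    ((2 * (Complex.I * t)) ^ (-(((a + 1) / 2 : ℝ) : ℂ)) *
      gauss (1 / (4 * (Complex.I * t))) x)).congr (ae_omega_of_forall_pos a fun y hy => ?_)
  simp only [kernelS_eq hx hy ht]
  ring

lemma integral_kernelS_mul_eq_chirpHankel (hx : 0 < x) (ht : t ≠ 0) :
    ∫ y, kernelS a x y t * f y ∂(omega a) = chirpHankel a t f x := by
  rw [chirpHankel, hankel, ← mul_assoc, ← integral_const_mul]
  refine integral_congr_ae (ae_omega_of_forall_pos a fun y hy => ?_)
  simp only [kernelS_eq hx hy ht]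
  ring

lemma polyGrowth_chirpHankel (ha : -1 < a) (h : SchwartzFamily fun _ : Unit => f) (t : ℝ) :
    RadialChain PolyGrowth 0 fun _ : Unit => chirpHankel a t f := by
  have hf := h.gauss_mul_single (re_one_div_four_mul_I_mul t).ge
  obtain ⟨C, hC0, hC⟩ := (hf 0).growth.exists_norm_hankel_le ha
  constructor
  · refine ⟨2, ‖(2 * (Complex.I * t)) ^ (-(((a + 1) / 2 : ℝ) : ℂ))‖ *
      (C * (1 + |1 / (2 * t)|) ^ 2), fun _ x hx => ?_⟩
    have hone : ‖gauss (1 / (4 * (Complex.I * t))) x‖ = 1 := by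
      rw [norm_gauss, re_one_div_four_mul_I_mul, neg_zero, zero_mul, Real.exp_zero]
    have hle : 1 + |1 / (2 * t) * x| ≤ (1 + |1 / (2 * t)|) * (1 + x) := by
      rw [abs_mul, abs_of_pos hx]
      nlinarith [abs_nonneg (1 / (2 * t))]
    simp only [chirpHankel]
    rw [norm_mul, norm_mul, hone, one_mul, mul_assoc, mul_assoc, ← mul_pow]
    gcongr
    exact (hC () _).trans (by gcongr)
  · have hcont := ((hf 0).continuous_hankel ha fun _ _ => continuous_const).comp
      (continuous_id.prodMk (continuous_const (y := ())))
    exact fun _ => (continuous_const.mul ((continuous_gauss _).mul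
      (hcont.comp (continuous_const.mul continuous_id)))).continuousOn

lemma chirpHankel_gauss (ha : -1 < a) (ht : t ≠ 0) {z : ℂ} (hz : 0 < z.re) (x : ℝ) :
    chirpHankel a t (gauss z) x = freeEvolution a t (gauss z) x := by
  rw [freeEvolution, hankel_gauss_mul_hankel_gauss ha (by simp) hz, chirpHankel]
  have hr : ((1 / (2 * t) : ℝ) : ℂ) ^ 2 = -(1 / (4 * (Complex.I * t) ^ 2)) := by
    push_cast
    rw [mul_pow, Complex.I_sq]
    ring
  have hc_re : (Complex.I * t).re = 0 := by simp
  have hc0 : Complex.I * t ≠ 0 := mul_ne_zero Complex.I_ne_zero (by exact_mod_cast ht)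
  have hre : 0 < (1 / (4 * (Complex.I * t)) + z).re := by
    rw [Complex.add_re, re_one_div_four_mul_I_mul]
    linarith
  generalize Complex.I * t = c at *
  have hw0 : 1 / (4 * c) + z ≠ 0 := fun h => by rw [h] at hre; exact hre.false
  have hprod : 1 + 4 * c * z = 2 * (2 * c) * (1 / (4 * c) + z) := by
    field_simp
    ring
  have hpow : (1 + 4 * c * z) ^ (-(((a + 1) / 2 : ℝ) : ℂ)) = ((2 ^ (-((a + 1) / 2)) : ℝ) : ℂ) *
      (2 * c) ^ (-(((a + 1) / 2 : ℝ) : ℂ)) * (1 / (4 * c) + z) ^ (-(((a + 1) / 2 : ℝ) : ℂ)) := by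
    rw [hprod, mul_cpow_of_re_nonneg (by simp [hc0]) (by simp [hc_re]) hre, mul_comm 2 (2 * c),
      mul_cpow_of_re_nonneg (by simp [hc0]) (by simp [hc_re]) (by simp), mul_comm (_ ^ _),
      Complex.ofReal_cpow zero_le_two]
    push_cast
    rfl
  have hexp : z / (1 + 4 * c * z) =
      1 / (4 * c) + -(1 / (4 * c ^ 2)) * (1 / (4 * (1 / (4 * c) + z))) := by
    have hz_eq : z = 1 / (4 * c) + z - 1 / (4 * c) := by ring
    rw [hprod]
    generalize 1 / (4 * c) + z = w at hz_eq hw0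
    rw [hz_eq]
    field_simp
    ring
  simp only [gauss_mul_gauss]
  rw [hankel_gauss ha hre, gauss_mul_left, hr, hpow, hexp, ← gauss_mul_gauss]
  ring

lemma integral_freeEvolution_mul (ha : -1 < a) (h : SchwartzFamily fun _ : Unit => f) {g : ℝ → ℂ}
    (hg : SchwartzFamily fun _ : Unit => g) (t : ℝ) :
    ∫ x, freeEvolution a t f x * g x ∂(omega a) = ∫ x, f x * freeEvolution a t g x ∂(omega a) := by
  have hI : 0 ≤ (Complex.I * (t : ℂ)).re := by simp
  have h₁ := integral_hankel_mul ha ((h.hankel ha).gauss_mul_single hI 0) (hg 0) () 1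
  have h₂ := integral_hankel_mul ha (h 0) ((hg.hankel ha).gauss_mul_single hI 0) () 1
  simp only [one_mul] at h₁ h₂
  calc _ = _ := h₁
    _ = ∫ x, hankel a f x * (gauss (Complex.I * t) x * hankel a g x) ∂(omega a) := by
      simp only [mul_assoc, mul_left_comm]
    _ = _ := h₂

lemma integral_chirpHankel_mul (ha : -1 < a) (h : SchwartzFamily fun _ : Unit => f) {g : ℝ → ℂ}
    (hg : SchwartzFamily fun _ : Unit => g) (t : ℝ) :
    ∫ x, chirpHankel a t f x * g x ∂(omega a) = ∫ x, f x * chirpHankel a t g x ∂(omega a) := by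
  have hI := (re_one_div_four_mul_I_mul t).ge
  have := integral_hankel_mul ha (h.gauss_mul_single hI 0) (hg.gauss_mul_single hI 0) ()
    (1 / (2 * t))
  have hl (x : ℝ) : chirpHankel a t f x * g x = (2 * (Complex.I * t)) ^ (-(((a + 1) / 2 : ℝ) : ℂ)) *
      (hankel a (fun y => gauss (1 / (4 * (Complex.I * t))) y * f y) (1 / (2 * t) * x) *
        (gauss (1 / (4 * (Complex.I * t))) x * g x)) := by rw [chirpHankel]; ring
  have hr (x : ℝ) : f x * chirpHankel a t g x = (2 * (Complex.I * t)) ^ (-(((a + 1) / 2 : ℝ) : ℂ)) *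
      (gauss (1 / (4 * (Complex.I * t))) x * f x *
        hankel a (fun y => gauss (1 / (4 * (Complex.I * t))) y * g y) (1 / (2 * t) * x)) := by
    rw [chirpHankel]
    ring
  simp only [hl, hr, integral_const_mul, this]

theorem integral_kernelS_mul (ha : -1 < a) (h : SchwartzFamily fun _ : Unit => f) (hx : 0 < x)
    (ht : t ≠ 0) : ∫ y, kernelS a x y t * f y ∂(omega a) = freeEvolution a t f x := by
  rw [integral_kernelS_mul_eq_chirpHankel hx ht]
  refine eqOn_of_integral_mul_gauss_eq ha (polyGrowth_chirpHankel ha h t)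
    (h.freeEvolution ha t 0).polyGrowth (fun z hz => ?_) hx
  rw [integral_chirpHankel_mul ha h (schwartzFamily_gauss hz),
    integral_freeEvolution_mul ha h (schwartzFamily_gauss hz)]
  simp only [chirpHankel_gauss ha ht hz]

end Kernel

/-! ### Duhamel's formula -/

section Duhamel

variable {a : ℝ} {A : ℝ → ℂ} {Φ Φ' G : ℝ → ℝ → ℂ}

/-- Continuity and rapid decay in space, locally uniformly in time. -/
def LocallyRapidDecay (Φ : ℝ → ℝ → ℂ) : Prop :=
  ∀ T, RadialChain RapidDecay 0 fun t : {t : ℝ // |t| ≤ T} => Φ t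

/-- Membership in `𝒮⁺` of all time slices, with bounds that are locally uniform in time. -/
def LocallySchwartz (Φ : ℝ → ℝ → ℂ) : Prop :=
  ∀ T, SchwartzFamily fun t : {t : ℝ // |t| ≤ T} => Φ t

lemma LocallyRapidDecay.slice (h : LocallyRapidDecay Φ) (t : ℝ) :
    RadialChain RapidDecay 0 fun _ : Unit => Φ t :=
  (h |t|).comp fun _ => ⟨t, le_rfl⟩

lemma LocallySchwartz.slice (h : LocallySchwartz Φ) (t : ℝ) : SchwartzFamily fun _ : Unit => Φ t :=
  (h |t|).comp fun _ => ⟨t, le_rfl⟩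

lemma LocallySchwartz.locallyRapidDecay (h : LocallySchwartz Φ) : LocallyRapidDecay Φ :=
  fun T => h T 0

lemma LocallyRapidDecay.hasDerivAt_hankel (ha : -1 < a) (hΦ : LocallyRapidDecay Φ)
    (hΦ' : LocallyRapidDecay Φ') (hd : ∀ t ξ, 0 < ξ → HasDerivAt (fun s => Φ s ξ) (Φ' t ξ) t)
    (t x : ℝ) : HasDerivAt (fun s => hankel a (Φ s) x) (hankel a (Φ' t) x) t := by
  obtain ⟨N, hN⟩ := exists_nat_gt (a + 1)
  obtain ⟨C, -, hC⟩ := (hΦ' (|t| + 1)).growth.exists_norm_normalizedBessel_mul_le ha N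
  have hbound : ∀ ξ, 0 < ξ → ∀ s ∈ Metric.ball t 1,
      ‖(normalizedBessel a (x * ξ) : ℂ) * Φ' s ξ‖ ≤ C * (1 + |x|) ^ 2 * ((1 + ξ) ^ N)⁻¹ := by
    intro ξ hξ s hs
    have hs_abs : |s| ≤ |t| + 1 := by
      rw [Metric.mem_ball, Real.dist_eq] at hs
      linarith [abs_sub_abs_le_abs_sub s t]
    exact hC ⟨s, hs_abs⟩ x ξ hξ
  have hint (s : ℝ) := integrable_normalizedBessel_mul ha ha (hΦ.slice s) () x
  exact (hasDerivAt_integral_of_dominated_loc_of_deriv_le (𝕜 := ℝ)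
    (F := fun s ξ => (normalizedBessel a (x * ξ) : ℂ) * Φ s ξ)
    (F' := fun s ξ => (normalizedBessel a (x * ξ) : ℂ) * Φ' s ξ)
    (Metric.ball_mem_nhds t one_pos) (.of_forall fun s => (hint s).aestronglyMeasurable) (hint t)
    (integrable_normalizedBessel_mul ha ha (hΦ'.slice t) () x).aestronglyMeasurable
    (ae_omega_of_forall_pos a hbound) ((integrable_inv_one_add_pow ha hN).const_mul _)
    (ae_omega_of_forall_pos a fun ξ hξ s _ => (hd s ξ hξ).const_mul _)).2

lemma RapidDecay.intervalIntegral {Ψ : ℝ → ℝ → ℝ → ℂ} {T : ℝ}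
    (h : RapidDecay fun q : {q : ℝ × ℝ // |q.1| ≤ T ∧ |q.2| ≤ T} => Ψ q.1.1 q.1.2) :
    RapidDecay fun (t : {t : ℝ // |t| ≤ T}) x => ∫ s in (0 : ℝ)..t, Ψ t s x := by
  intro m
  obtain ⟨C, hC⟩ := h m
  refine ⟨C * T, fun ⟨t, ht⟩ x hx => ?_⟩
  have hC_nonneg : 0 ≤ C * ((1 + x) ^ m)⁻¹ :=
    (norm_nonneg _).trans (hC ⟨(t, t), ht, ht⟩ x hx)
  calc ‖∫ s in (0 : ℝ)..t, Ψ t s x‖ ≤ C * ((1 + x) ^ m)⁻¹ * |t - 0| := by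
        refine intervalIntegral.norm_integral_le_of_norm_le_const fun s hs => ?_
        have hs_abs := abs_sub_left_of_mem_uIcc (uIoc_subset_uIcc hs)
        rw [sub_zero, sub_zero] at hs_abs
        exact hC ⟨(t, s), ht, hs_abs.trans ht⟩ x hx
    _ ≤ C * ((1 + x) ^ m)⁻¹ * T := by
        rw [sub_zero]
        gcongr
    _ = C * T * ((1 + x) ^ m)⁻¹ := by ring

lemma LocallyRapidDecay.intervalIntegral_hankel (ha : -1 < a) (h : LocallyRapidDecay Φ)
    (hc : Continuous fun q : ℝ × ℝ => Φ q.2 q.1) (t x : ℝ) :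
    ∫ s in (0 : ℝ)..t, hankel a (Φ s) x = hankel a (fun ξ => ∫ s in (0 : ℝ)..t, Φ s ξ) x := by
  obtain ⟨N, hN⟩ := exists_nat_gt (a + 1)
  obtain ⟨C, -, hC⟩ := (h |t|).growth.exists_norm_normalizedBessel_mul_le ha N
  have hfin : IsFiniteMeasure (volume.restrict (uIoc 0 t)) := ⟨by simp [uIoc]⟩
  have hcont : Continuous fun q : ℝ × ℝ => (normalizedBessel a (x * q.2) : ℂ) * Φ q.1 q.2 :=
    (Complex.continuous_ofReal.comp ((continuous_normalizedBessel ha).comp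
      (continuous_const.mul continuous_snd))).mul (hc.comp continuous_swap)
  have hmem : ∀ᵐ q ∂((volume.restrict (uIoc 0 t)).prod (omega a)), q.1 ∈ uIoc 0 t ∧ 0 < q.2 :=
    (Measure.quasiMeasurePreserving_fst.ae (ae_restrict_mem measurableSet_uIoc)).and
      (Measure.quasiMeasurePreserving_snd.ae (ae_omega_of_forall_pos a fun _ hx => hx))
  have hint : Integrable (fun q : ℝ × ℝ => (normalizedBessel a (x * q.2) : ℂ) * Φ q.1 q.2)
      ((volume.restrict (uIoc 0 t)).prod (omega a)) := by
    refine (((integrable_inv_one_add_pow ha hN).const_mul (C * (1 + |x|) ^ 2)).comp_snd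
      (volume.restrict (uIoc 0 t))).mono' hcont.aestronglyMeasurable ?_
    filter_upwards [hmem] with q ⟨hs, hξ⟩
    have hs_abs := abs_sub_left_of_mem_uIcc (uIoc_subset_uIcc hs)
    rw [sub_zero, sub_zero] at hs_abs
    exact hC ⟨q.1, hs_abs⟩ x q.2 hξ
  simp only [hankel, intervalIntegral.intervalIntegral_eq_integral_uIoc]
  rw [integral_integral_swap hint, ← integral_smul]
  simp only [integral_const_mul, mul_smul_comm]

/-- The Hankel transforms `A` of an initial value and `G s` of a source at time `s`. -/
structure HankelData (A : ℝ → ℂ) (G : ℝ → ℝ → ℂ) : Prop where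
  initial : SchwartzFamily fun _ : Unit => A
  source : LocallySchwartz G
  continuous_source : Continuous fun q : ℝ × ℝ => G q.1 q.2

/-- The solution `v` of the ordinary differential equations `∂ₜ v = -i ξ² v + G t ξ`, `v 0 = A`,
to which the Hankel transform reduces the Cauchy problem. -/
def duhamel (A : ℝ → ℂ) (G : ℝ → ℝ → ℂ) (t ξ : ℝ) : ℂ :=
  gauss (Complex.I * t) ξ * (A ξ + ∫ s in (0 : ℝ)..t, gauss (-(Complex.I * s)) ξ * G s ξ)

lemma duhamel_sq_mul (A : ℝ → ℂ) (G : ℝ → ℝ → ℂ) (t ξ : ℝ) :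
    duhamel (fun ξ => (ξ : ℂ) ^ 2 * A ξ) (fun s ξ => (ξ : ℂ) ^ 2 * G s ξ) t ξ =
      (ξ : ℂ) ^ 2 * duhamel A G t ξ := by
  simp only [duhamel, mul_left_comm (gauss _ ξ) ((ξ : ℂ) ^ 2), intervalIntegral.integral_const_mul]
  ring

lemma duhamel_eq (A : ℝ → ℂ) (G : ℝ → ℝ → ℂ) (t ξ : ℝ) : duhamel A G t ξ =
    gauss (Complex.I * t) ξ * A ξ +
      ∫ s in (0 : ℝ)..t, gauss (Complex.I * ((t - s : ℝ) : ℂ)) ξ * G s ξ := by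
  have hgauss (s : ℝ) : gauss (Complex.I * ((t - s : ℝ) : ℂ)) ξ =
      gauss (Complex.I * t) ξ * gauss (-(Complex.I * s)) ξ := by
    rw [gauss_mul_gauss]
    push_cast
    ring_nf
  simp only [hgauss, mul_assoc, intervalIntegral.integral_const_mul, duhamel, mul_add]

lemma hasDerivAt_gauss_I_mul (t ξ : ℝ) : HasDerivAt (fun t : ℝ => gauss (Complex.I * t) ξ)
    (-Complex.I * ((ξ : ℂ) ^ 2 * gauss (Complex.I * t) ξ)) t := by
  refine (((hasDerivAt_id' t).ofReal_comp.const_mul Complex.I).fun_neg.mul_const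
    ((ξ : ℂ) ^ 2)).cexp.congr_deriv ?_
  simp only [gauss]
  push_cast
  ring

namespace HankelData

lemma sq_mul (h : HankelData A G) :
    HankelData (fun ξ => (ξ : ℂ) ^ 2 * A ξ) (fun s ξ => (ξ : ℂ) ^ 2 * G s ξ) where
  initial n := (h.initial n).sq_mul
  source T n := (h.source T n).sq_mul
  continuous_source := by have := h.continuous_source; fun_prop

lemma hasDerivAt_duhamel (h : HankelData A G) (t ξ : ℝ) : HasDerivAt (fun t => duhamel A G t ξ)
    (-Complex.I * ((ξ : ℂ) ^ 2 * duhamel A G t ξ) + G t ξ) t := by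
  have hcont : Continuous fun s : ℝ => gauss (-(Complex.I * s)) ξ * G s ξ := by
    have := h.continuous_source
    unfold gauss
    fun_prop
  have hinv : gauss (Complex.I * t) ξ * gauss (-(Complex.I * t)) ξ = 1 := by
    rw [gauss_mul_gauss]
    simp [gauss]
  refine ((hasDerivAt_gauss_I_mul t ξ).mul
    ((hcont.integral_hasStrictDerivAt 0 t).hasDerivAt.const_add (A ξ))).congr_deriv ?_
  rw [duhamel]
  linear_combination G t ξ * hinv

lemma schwartzFamily_gauss_mul_initial (h : HankelData A G) (T : ℝ) :
    SchwartzFamily fun (t : {t : ℝ // |t| ≤ T}) ξ => gauss (Complex.I * (t : ℝ)) ξ * A ξ :=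
  (h.initial.comp fun _ => ()).gauss_mul (M := T) (fun t => by simpa using t.2) (by simp)

lemma schwartzFamily_gauss_mul_source (h : HankelData A G) (T : ℝ) :
    SchwartzFamily fun (q : {q : ℝ × ℝ // |q.1| ≤ T ∧ |q.2| ≤ T}) ξ =>
      gauss (Complex.I * ((q.1.1 - q.1.2 : ℝ) : ℂ)) ξ * G q.1.2 ξ := by
  refine ((h.source T).comp fun q : {q : ℝ × ℝ // |q.1| ≤ T ∧ |q.2| ≤ T} =>
    ⟨q.1.2, q.2.2⟩).gauss_mul (M := T + T) (fun q => ?_) (by simp)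
  rw [norm_mul, Complex.norm_I, one_mul, Complex.norm_real]
  exact (abs_sub _ _).trans (add_le_add q.2.1 q.2.2)

lemma continuous_gauss_mul_source (h : HankelData A G) (t : ℝ) :
    Continuous fun q : ℝ × ℝ => gauss (Complex.I * ((t - q.2 : ℝ) : ℂ)) q.1 * G q.2 q.1 := by
  have := h.continuous_source
  unfold gauss
  fun_prop

lemma locallyRapidDecay_gauss_mul_source (h : HankelData A G) (t : ℝ) :
    LocallyRapidDecay fun s ξ => gauss (Complex.I * ((t - s : ℝ) : ℂ)) ξ * G s ξ :=
  fun T => (h.schwartzFamily_gauss_mul_source (max |t| T) 0).comp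
    fun s : {s : ℝ // |s| ≤ T} => ⟨(t, s), le_max_left _ _, s.2.trans (le_max_right _ _)⟩

lemma locallyRapidDecay_intervalIntegral (h : HankelData A G) : LocallyRapidDecay fun t ξ =>
    ∫ s in (0 : ℝ)..t, gauss (Complex.I * ((t - s : ℝ) : ℂ)) ξ * G s ξ := fun T => by
  have h_decay := RapidDecay.intervalIntegral
    (Ψ := fun t s ξ => gauss (Complex.I * ((t - s : ℝ) : ℂ)) ξ * G s ξ)
    (h.schwartzFamily_gauss_mul_source T 0).growth
  exact ⟨h_decay, fun t => (intervalIntegral.continuous_parametric_intervalIntegral_of_continuous'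
    (h.continuous_gauss_mul_source t) 0 t).continuousOn⟩

lemma locallyRapidDecay_duhamel (h : HankelData A G) : LocallyRapidDecay (duhamel A G) :=
  fun T => ((h.schwartzFamily_gauss_mul_initial T 0).add
    (h.locallyRapidDecay_intervalIntegral T)).congr fun t ξ _ => (duhamel_eq A G t ξ).symm

end HankelData

/-- The solution of the Cauchy problem whose data have the Hankel transforms `A` and `G`. -/
def solution (a : ℝ) (A : ℝ → ℂ) (G : ℝ → ℝ → ℂ) (t x : ℝ) : ℂ := hankel a (duhamel A G t) x

lemma solution_sq_mul (A : ℝ → ℂ) (G : ℝ → ℝ → ℂ) (t x : ℝ) :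
    solution a (fun ξ => (ξ : ℂ) ^ 2 * A ξ) (fun s ξ => (ξ : ℂ) ^ 2 * G s ξ) t x =
      hankel a (fun ξ => (ξ : ℂ) ^ 2 * duhamel A G t ξ) x := by
  simp only [solution, hankel, duhamel_sq_mul]

namespace HankelData

lemma solution_eq (h : HankelData A G) (ha : -1 < a) (t x : ℝ) : solution a A G t x =
    hankel a (fun ξ => gauss (Complex.I * t) ξ * A ξ) x + ∫ s in (0 : ℝ)..t,
      hankel a (fun ξ => gauss (Complex.I * ((t - s : ℝ) : ℂ)) ξ * G s ξ) x := by
  have hA := h.initial.gauss_mul_single (c := Complex.I * t) (by simp)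
  rw [(h.locallyRapidDecay_gauss_mul_source t).intervalIntegral_hankel ha
    (h.continuous_gauss_mul_source t)]
  simp only [solution, hankel, duhamel_eq, mul_add]
  exact integral_add (integrable_normalizedBessel_mul ha ha (hA 0) () x)
    (integrable_normalizedBessel_mul ha ha (h.locallyRapidDecay_intervalIntegral.slice t) () x)

lemma locallyRapidDecay_solution (h : HankelData A G) (ha : -1 < a) :
    LocallyRapidDecay (solution a A G) := fun T => by
  refine ⟨?_, fun t x _ => ((h.locallyRapidDecay_duhamel T).hasDerivAt_hankel ha t x).continuousAt
    |>.continuousWithinAt⟩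
  have hsum := ((h.schwartzFamily_gauss_mul_initial T).hankel ha 0).growth.add
    (RapidDecay.intervalIntegral
      (Ψ := fun t s => hankel a fun ξ => gauss (Complex.I * ((t - s : ℝ) : ℂ)) ξ * G s ξ)
      ((h.schwartzFamily_gauss_mul_source T).hankel ha 0).growth)
  simpa only [← h.solution_eq ha] using hsum

lemma hasDerivAt_solution (h : HankelData A G) (ha : -1 < a) (t x : ℝ) :
    HasDerivAt (fun t => solution a A G t x) (-Complex.I * solution a (fun ξ => (ξ : ℂ) ^ 2 * A ξ)
      (fun s ξ => (ξ : ℂ) ^ 2 * G s ξ) t x + hankel a (G t) x) t := by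
  have hv := h.locallyRapidDecay_duhamel
  have hv' : LocallyRapidDecay fun t ξ => -Complex.I * ((ξ : ℂ) ^ 2 * duhamel A G t ξ) + G t ξ :=
    fun T => ((hv T).sq_mul.const_mul _).add (h.source T 0)
  refine (hv.hasDerivAt_hankel ha hv' (fun t ξ _ => h.hasDerivAt_duhamel t ξ) t x).congr_deriv ?_
  rw [solution_sq_mul, hankel, hankel, hankel, ← integral_const_mul, ← integral_add
    ((integrable_normalizedBessel_mul ha ha (hv.slice t).sq_mul () x).const_mul _)
    (integrable_normalizedBessel_mul ha ha (h.source.slice t 0) () x)]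
  simp only [mul_add, mul_left_comm (normalizedBessel _ _ : ℂ) (-Complex.I)]

end HankelData

end Duhamel

/-! ### The data of the Cauchy problem -/

section Data

variable {ι : Type*} {φ : ι → ℝ → ℂ}

lemma contDiffOn_radialDeriv {f : ℝ → ℂ} (hf : ContDiffOn ℝ ∞ f (Ioi 0)) :
    ContDiffOn ℝ ∞ (radialDeriv f) (Ioi 0) := by
  have hinv : ContDiffOn ℝ ∞ (fun x : ℝ => 1 / x) (Ioi 0) :=
    contDiffOn_const.div contDiffOn_id fun x hx => ne_of_gt hx
  exact (Complex.ofRealCLM.contDiff.comp_contDiffOn hinv).mul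
    (hf.deriv_of_isOpen isOpen_Ioi (by simp))

lemma contDiffOn_iterate_radialDeriv {f : ℝ → ℂ} (hf : ContDiffOn ℝ ∞ f (Ioi 0)) (k : ℕ) :
    ContDiffOn ℝ ∞ (radialDeriv^[k] f) (Ioi 0) := by
  induction k with
  | zero => exact hf
  | succ k ih => rw [Function.iterate_succ_apply']; exact contDiffOn_radialDeriv ih

lemma hasRadialDeriv_radialDeriv {f : ℝ → ℂ} (hf : ContDiffOn ℝ ∞ f (Ioi 0)) :
    HasRadialDeriv f (radialDeriv f) := fun x hx => by
  have hx' : (x : ℂ) ≠ 0 := Complex.ofReal_ne_zero.2 hx.ne'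
  have hdiff : DifferentiableAt ℝ f x :=
    (hf.differentiableOn (by simp)).differentiableAt (Ioi_mem_nhds hx)
  refine hdiff.hasDerivAt.congr_deriv ?_
  rw [radialDeriv]
  push_cast
  field_simp

lemma rapidDecay_of_pow_mul_le (h : ∀ m : ℕ, ∃ C, ∀ i x, 0 < x → x ^ m * ‖φ i x‖ ≤ C) :
    RapidDecay φ := by
  intro m
  obtain ⟨C₀, hC₀⟩ := h 0
  obtain ⟨C, hC⟩ := h (2 * m)
  refine ⟨2 ^ m * (C₀ + C), fun i x hx => ?_⟩
  rw [← div_eq_mul_inv, le_div_iff₀' (by positivity)]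
  calc (1 + x) ^ m * ‖φ i x‖ ≤ 2 ^ m * (1 + (x ^ 2) ^ m) * ‖φ i x‖ := by
        gcongr
        exact one_add_pow_le m hx
    _ = 2 ^ m * (x ^ 0 * ‖φ i x‖ + x ^ (2 * m) * ‖φ i x‖) := by ring
    _ ≤ 2 ^ m * (C₀ + C) := by
        gcongr
        exacts [hC₀ i x hx, hC i x hx]

lemma schwartzFamily_of_radialDeriv (hs : ∀ i, ContDiffOn ℝ ∞ (φ i) (Ioi 0))
    (hb : ∀ m k : ℕ, ∃ C, ∀ i x, 0 < x → x ^ m * ‖radialDeriv^[k] (φ i) x‖ ≤ C) :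
    SchwartzFamily φ := by
  have hdecay (k : ℕ) : RapidDecay fun i => radialDeriv^[k] (φ i) :=
    rapidDecay_of_pow_mul_le fun m => hb m k
  have hchain (n k : ℕ) : RadialChain RapidDecay n fun i => radialDeriv^[k] (φ i) := by
    induction n generalizing k with
    | zero => exact ⟨hdecay k, fun i => (contDiffOn_iterate_radialDeriv (hs i) k).continuousOn⟩
    | succ n ih =>
      refine ⟨hdecay k, _, ih (k + 1), fun i => ?_⟩
      rw [Function.iterate_succ_apply']
      exact hasRadialDeriv_radialDeriv (contDiffOn_iterate_radialDeriv (hs i) k)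
  exact fun n => hchain n 0

lemma IsSchwartzPlus.schwartzFamily {f : ℝ → ℂ} (h : IsSchwartzPlus f) :
    SchwartzFamily fun _ : Unit => f := by
  refine schwartzFamily_of_radialDeriv (fun _ => h.smooth) fun m k => ?_
  obtain ⟨C, hC⟩ := h.bounded m k
  refine ⟨C, fun _ x hx => ?_⟩
  simpa [abs_of_pos hx] using hC x hx

lemma pow_le_one_add_sq_add_sq_rpow {x : ℝ} (hx : 0 < x) (t : ℝ) {m p : ℕ} (hmp : m ≤ p) :
    x ^ m ≤ (1 + x ^ 2 + t ^ 2) ^ ((p : ℝ) / 2) := by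
  calc x ^ m = (x ^ 2) ^ ((m : ℝ) / 2) := by
        rw [← Real.rpow_natCast_mul hx.le, Nat.cast_ofNat, mul_div_cancel₀ _ two_ne_zero,
          Real.rpow_natCast]
    _ ≤ (1 + x ^ 2 + t ^ 2) ^ ((m : ℝ) / 2) := by
        gcongr
        linarith [sq_nonneg t]
    _ ≤ (1 + x ^ 2 + t ^ 2) ^ ((p : ℝ) / 2) := by
        gcongr
        linarith [sq_nonneg x, sq_nonneg t]

namespace IsSpaceTimeSchwartzPlus

variable {F : ℝ → ℝ → ℂ}

lemma schwartzFamily (h : IsSpaceTimeSchwartzPlus F) : SchwartzFamily fun t x => F x t := by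
  refine schwartzFamily_of_radialDeriv (fun t => h.smooth.comp (f := fun x : ℝ => (x, t))
    (by fun_prop) fun x hx => ⟨hx, mem_univ _⟩) fun m k => ?_
  obtain ⟨C, hC⟩ := h.bounded (m + k)
  refine ⟨C, fun t x hx => ?_⟩
  have hbound := hC k 0 (by lia) x hx t
  simp only [iteratedDeriv_zero] at hbound
  refine le_trans ?_ hbound
  gcongr
  exact pow_le_one_add_sq_add_sq_rpow hx t (by lia)

lemma locallySchwartz (h : IsSpaceTimeSchwartzPlus F) : LocallySchwartz fun t x => F x t :=
  fun _ => h.schwartzFamily.comp Subtype.val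

lemma continuous_time (h : IsSpaceTimeSchwartzPlus F) {x : ℝ} (hx : 0 < x) :
    Continuous (F x) :=
  h.smooth.continuousOn.comp_continuous (f := fun t : ℝ => (x, t)) (by fun_prop)
    fun _ => ⟨hx, mem_univ _⟩

end IsSpaceTimeSchwartzPlus

lemma LocallyRapidDecay.continuous_hankel {a : ℝ} (ha : -1 < a) {Φ : ℝ → ℝ → ℂ}
    (h : LocallyRapidDecay Φ) (hc : ∀ x, 0 < x → Continuous fun t => Φ t x) :
    Continuous fun q : ℝ × ℝ => hankel a (Φ q.1) q.2 := by
  refine continuous_iff_continuousAt.2 fun ⟨t, x⟩ => ?_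
  have hopen : IsOpenEmbedding (Prod.map id Subtype.val : ℝ × {s : ℝ // |s| < |t| + 1} → ℝ × ℝ) :=
    .prodMap .id (isOpen_lt continuous_abs continuous_const).isOpenEmbedding_subtypeVal
  have hlocal : Continuous fun q : ℝ × {s : ℝ // |s| < |t| + 1} => hankel a (Φ q.2) q.1 :=
    ((h (|t| + 1)).comp fun s : {s : ℝ // |s| < |t| + 1} => ⟨s, s.2.le⟩).continuous_hankel ha
      fun x hx => (hc x hx).comp continuous_subtype_val
  have hswap : ContinuousAt (fun q : ℝ × ℝ => hankel a (Φ q.2) q.1) (x, t) :=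
    (hopen.continuousAt_iff (x := (x, ⟨t, lt_add_one _⟩))).1 hlocal.continuousAt
  exact hswap.comp (f := Prod.swap) (x := (t, x)) continuous_swap.continuousAt

lemma hankelData {a : ℝ} (ha : -1 < a) {f : ℝ → ℂ} {F : ℝ → ℝ → ℂ}
    (hf : SchwartzFamily fun _ : Unit => f) (hF : LocallySchwartz fun t x => F x t)
    (hc : ∀ x, 0 < x → Continuous (F x)) :
    HankelData (hankel a f) fun t => hankel a fun x => F x t where
  initial := hf.hankel ha
  source T := (hF T).hankel ha
  continuous_source := LocallyRapidDecay.continuous_hankel ha hF.locallyRapidDecay hc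

end Data

/-! ### Curves in `L²` -/

section Curves

lemma tendsto_toLp_of_dominated {α κ E : Type*} [MeasurableSpace α] [NormedAddCommGroup E]
    {μ : Measure α} {p : ENNReal} [hp : Fact (1 ≤ p)] (hp_top : p ≠ ⊤) {l : Filter κ}
    [l.IsCountablyGenerated] {f : κ → α → E} {g : α → E} {bound : α → ℝ} (hf : ∀ k, MemLp (f k) p μ)
    (hg : MemLp g p μ) (hbound : MemLp bound p μ)
    (h_le : ∀ᶠ k in l, ∀ᵐ x ∂μ, ‖f k x - g x‖ ≤ bound x)
    (h_lim : ∀ᵐ x ∂μ, Tendsto (fun k => f k x) l (𝓝 (g x))) :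
    Tendsto (fun k => (hf k).toLp (f k)) l (𝓝 (hg.toLp g)) := by
  have hp_zero : p ≠ 0 := (zero_lt_one.trans_le hp.out).ne'
  have hp_pos : 0 < p.toReal := ENNReal.toReal_pos hp_zero hp_top
  rw [Lp.tendsto_Lp_iff_tendsto_eLpNorm'']
  simp only [eLpNorm_eq_lintegral_rpow_enorm_toReal hp_zero hp_top, Pi.sub_apply]
  have h_int : Tendsto (fun k => ∫⁻ x, ‖f k x - g x‖ₑ ^ p.toReal ∂μ) l (𝓝 (∫⁻ _, 0 ∂μ)) := by
    refine tendsto_lintegral_filter_of_dominated_convergence' (fun x => ‖bound x‖ₑ ^ p.toReal)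
      (.of_forall fun k => ((hf k).1.sub hg.1).enorm.pow_const _) ?_
      (lintegral_rpow_enorm_lt_top_of_eLpNorm_lt_top hp_zero hp_top hbound.2).ne ?_
    · filter_upwards [h_le] with k hk
      filter_upwards [hk] with x hx
      gcongr
      exact enorm_le_iff_norm_le.2 (hx.trans (le_abs_self _))
    · filter_upwards [h_lim] with x hx
      have h_zero : Tendsto (fun k => ‖f k x - g x‖ₑ) l (𝓝 0) := by
        simpa using (hx.sub_const (g x)).enorm
      simpa [hp_pos] using h_zero.ennrpow_const p.toReal
  simpa [hp_pos] using h_int.ennrpow_const (1 / p.toReal)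

namespace LocallyRapidDecay

variable {a : ℝ} {Φ Φ' : ℝ → ℝ → ℂ}

lemma memLp (ha : -1 < a) (h : LocallyRapidDecay Φ) (t : ℝ) : MemLp (Φ t) 2 (omega a) := by
  obtain ⟨N, hN⟩ := exists_nat_gt (a + 1)
  obtain ⟨hdecay, hcont⟩ := h.slice t
  obtain ⟨C, hC⟩ := hdecay N
  exact ((memLp_inv_one_add_pow ha hN).const_mul C).mono' (aestronglyMeasurable_omega (hcont ()))
    (ae_omega_of_forall_pos a (hC ()))

lemma exists_norm_le (h : LocallyRapidDecay Φ) (N : ℕ) (t : ℝ) :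
    ∃ C, ∀ s ∈ Metric.ball t 1, ∀ x, 0 < x → ‖Φ s x‖ ≤ C * ((1 + x) ^ N)⁻¹ := by
  obtain ⟨C, hC⟩ := (h (|t| + 1)).growth N
  refine ⟨C, fun s hs => hC ⟨s, ?_⟩⟩
  rw [Metric.mem_ball, Real.dist_eq] at hs
  linarith [abs_sub_abs_le_abs_sub s t]

lemma continuous_toLp (ha : -1 < a) (h : LocallyRapidDecay Φ)
    (hc : ∀ x, 0 < x → Continuous fun t => Φ t x) :
    Continuous fun t => (h.memLp ha t).toLp (Φ t) := by
  obtain ⟨N, hN⟩ := exists_nat_gt (a + 1)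
  refine continuous_iff_continuousAt.2 fun t => ?_
  obtain ⟨C, hC⟩ := h.exists_norm_le N t
  refine tendsto_toLp_of_dominated (by simp) (h.memLp ha) (h.memLp ha t)
    ((memLp_inv_one_add_pow ha hN).const_mul (C + C)) ?_
    (ae_omega_of_forall_pos a fun x hx => (hc x hx).continuousAt)
  filter_upwards [Metric.ball_mem_nhds t one_pos] with s hs
  refine ae_omega_of_forall_pos a fun x hx => (norm_sub_le _ _).trans ?_
  rw [add_mul]
  exact add_le_add (hC s hs x hx) (hC t (Metric.mem_ball_self one_pos) x hx)

lemma hasDerivAt_toLp (ha : -1 < a) (hΦ : LocallyRapidDecay Φ) (hΦ' : LocallyRapidDecay Φ')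
    (hd : ∀ t x, 0 < x → HasDerivAt (fun s => Φ s x) (Φ' t x) t) (t : ℝ) :
    HasDerivAt (fun t => (hΦ.memLp ha t).toLp (Φ t)) ((hΦ'.memLp ha t).toLp (Φ' t)) t := by
  obtain ⟨N, hN⟩ := exists_nat_gt (a + 1)
  obtain ⟨C, hC⟩ := hΦ'.exists_norm_le N t
  have hslope (s : ℝ) : MemLp (fun x => slope (fun r => Φ r x) t s) 2 (omega a) := by
    simp only [slope_def_module]
    exact ((hΦ.memLp ha s).sub (hΦ.memLp ha t)).const_smul (s - t)⁻¹
  have hmean : ∀ s ∈ Metric.ball t 1, ∀ x, 0 < x →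
      ‖slope (fun r => Φ r x) t s‖ ≤ C * ((1 + x) ^ N)⁻¹ := fun s hs x hx => by
    rcases eq_or_ne s t with rfl | hst
    · rw [slope_same, norm_zero]
      exact (norm_nonneg _).trans (hC s hs x hx)
    rw [slope_def_module, norm_smul, norm_inv, inv_mul_le_iff₀ (norm_pos_iff.2 (sub_ne_zero.2 hst)),
      mul_comm]
    exact (convex_ball t 1).norm_image_sub_le_of_norm_hasDerivWithin_le
      (fun r _ => (hd r x hx).hasDerivWithinAt) (fun r hr => hC r hr x hx)
      (Metric.mem_ball_self one_pos) hs
  have hlim : Tendsto (fun s => (hslope s).toLp _) (𝓝[≠] t) (𝓝 ((hΦ'.memLp ha t).toLp (Φ' t))) := by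
    refine tendsto_toLp_of_dominated (by simp) hslope (hΦ'.memLp ha t)
      ((memLp_inv_one_add_pow ha hN).const_mul (C + C)) ?_
      (ae_omega_of_forall_pos a fun x hx => hasDerivAt_iff_tendsto_slope.1 (hd t x hx))
    filter_upwards [nhdsWithin_le_nhds (Metric.ball_mem_nhds t one_pos)] with s hs
    refine ae_omega_of_forall_pos a fun x hx => (norm_sub_le _ _).trans ?_
    rw [add_mul]
    exact add_le_add (hmean s hs x hx) (hC t (Metric.mem_ball_self one_pos) x hx)
  refine hasDerivAt_iff_tendsto_slope.2 (hlim.congr fun s => ?_)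
  simp only [slope_def_module]
  rfl

lemma exists_contDiff_Lp (ha : -1 < a) (hΦ : LocallyRapidDecay Φ) (hΦ' : LocallyRapidDecay Φ')
    (hd : ∀ t x, 0 < x → HasDerivAt (fun s => Φ s x) (Φ' t x) t)
    (hc : ∀ x, 0 < x → Continuous fun t => Φ' t x) :
    ∃ U : ℝ → Lp ℂ 2 (omega a), ContDiff ℝ 1 U ∧ ∀ t, (U t : ℝ → ℂ) =ᵐ[omega a] Φ t := by
  have hderiv := hΦ.hasDerivAt_toLp ha hΦ' hd
  refine ⟨fun t => (hΦ.memLp ha t).toLp (Φ t), contDiff_one_iff_deriv.2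
    ⟨fun t => (hderiv t).differentiableAt, ?_⟩, fun t => (hΦ.memLp ha t).coeFn_toLp⟩
  rw [funext fun t => (hderiv t).deriv]
  exact hΦ'.continuous_toLp ha hc

end LocallyRapidDecay

end Curves

/-! ### Existence -/

section Existence

variable {a : ℝ} {ι : Type*} {φ : ι → ℝ → ℂ}

lemma RadialChain.contDiff_hankel (ha : -1 < a) (h : RadialChain RapidDecay 0 φ) (i : ι) (n : ℕ) :
    ContDiff ℝ n (hankel a (φ i)) := by
  induction n generalizing a with
  | zero =>
    exact contDiff_zero.2
      (continuous_iff_continuousAt.2 fun ξ => (h.hasDerivAt_hankel ha i ξ).continuousAt)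
  | succ n ih =>
    rw [Nat.cast_add_one]
    refine contDiff_succ_iff_deriv.2
      ⟨fun ξ => (h.hasDerivAt_hankel ha i ξ).differentiableAt, by simp, ?_⟩
    rw [funext fun ξ => (h.hasDerivAt_hankel ha i ξ).deriv]
    exact Complex.ofRealCLM.contDiff.mul (ih (a := a + 2) (by linarith)).neg

lemma RadialChain.besselOp_hankel (ha : -1 < a) (h : RadialChain RapidDecay 0 φ) (i : ι) {x : ℝ}
    (hx : 0 < x) :
    HalfLine.besselOp a (hankel a (φ i)) x = -hankel a (fun ξ => (ξ : ℂ) ^ 2 * φ i ξ) x := by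
  have hderiv : HasRadialDeriv (hankel a (φ i)) fun x => -hankel (a + 2) (φ i) x :=
    fun x _ => h.hasDerivAt_hankel ha i x
  have hderiv₂ : HasRadialDeriv (fun x => -hankel (a + 2) (φ i) x)
      fun x => -(-hankel (a + 2 + 2) (φ i) x) := fun x _ =>
    (h.hasDerivAt_hankel (a := a + 2) (by linarith) i x).fun_neg.congr_deriv (by ring)
  rw [hderiv.besselOp_eq hderiv₂ hx, h.hankel_sq_mul ha]
  ring

lemma RadialChain.tendsto_rpow_mul_deriv_hankel (ha : -1 < a) (h : RadialChain RapidDecay 0 φ)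
    (i : ι) : Tendsto (fun x => ((x ^ a : ℝ) : ℂ) * deriv (hankel a (φ i)) x) (𝓝[>] 0) (𝓝 0) := by
  have hpow : Tendsto (fun x : ℝ => ((x ^ (a + 1) : ℝ) : ℂ)) (𝓝[>] 0) (𝓝 0) := by
    have hcont : ContinuousAt (fun x : ℝ => ((x ^ (a + 1) : ℝ) : ℂ)) 0 :=
      (Real.continuousAt_rpow_const 0 (a + 1) (.inr (by linarith))).ofReal
    simpa [Real.zero_rpow (by linarith : a + 1 ≠ 0)] using hcont.tendsto.mono_left
      nhdsWithin_le_nhds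
  have hhankel : Tendsto (hankel (a + 2) (φ i)) (𝓝[>] 0) (𝓝 (hankel (a + 2) (φ i) 0)) :=
    ((h.hasDerivAt_hankel (a := a + 2) (by linarith) i 0).continuousAt.tendsto).mono_left
      nhdsWithin_le_nhds
  have hlim := hpow.mul hhankel.neg
  rw [zero_mul] at hlim
  refine hlim.congr' (eventually_mem_nhdsWithin.mono fun x hx => ?_)
  simp only [(h.hasDerivAt_hankel ha i x).deriv]
  rw [Real.rpow_add_one (ne_of_gt hx)]
  push_cast
  ring

namespace HankelData

variable {A : ℝ → ℂ} {G : ℝ → ℝ → ℂ}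

lemma exists_contDiff_Lp (h : HankelData A G) (ha : -1 < a) : ∃ U : ℝ → Lp ℂ 2 (omega a),
    ContDiff ℝ 1 U ∧ ∀ t, (U t : ℝ → ℂ) =ᵐ[omega a] solution a A G t := by
  refine (h.locallyRapidDecay_solution ha).exists_contDiff_Lp ha
    (fun T => (h.sq_mul.locallyRapidDecay_solution ha T).const_mul (-Complex.I) |>.add
      ((h.source T).hankel ha 0))
    (fun t x _ => h.hasDerivAt_solution ha t x) fun x _ => Continuous.add ?_ ?_
  · exact continuous_const.mul (continuous_iff_continuousAt.2
      fun t => (h.sq_mul.hasDerivAt_solution ha t x).continuousAt)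
  · exact (h.source.locallyRapidDecay.continuous_hankel ha
      fun ξ _ => h.continuous_source.comp (Continuous.prodMk_left ξ)).comp
        (Continuous.prodMk_left x)

lemma isSolution (h : HankelData A G) (ha : -1 < a) :
    IsSolution a (hankel a A) (fun x t => hankel a (G t) x) fun x t => solution a A G t x where
  contDiff_space t := ((h.locallyRapidDecay_duhamel.slice t).contDiff_hankel ha () 2).contDiffOn
  differentiable_time x _ t := (h.hasDerivAt_solution ha t x).differentiableAt
  contDiff_L2 := h.exists_contDiff_Lp ha
  equation x hx t := by
    have hbessel : besselOp a (fun z => solution a A G t z) x =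
        -hankel a (fun ξ => (ξ : ℂ) ^ 2 * duhamel A G t ξ) x :=
      (h.locallyRapidDecay_duhamel.slice t).besselOp_hankel ha () hx
    rw [(h.hasDerivAt_solution ha t x).deriv, hbessel, solution_sq_mul]
    ring
  neumann t := (h.locallyRapidDecay_duhamel.slice t).tendsto_rpow_mul_deriv_hankel ha ()
  initial x _ := by
    have hzero : duhamel A G 0 = A := funext fun ξ => by simp [duhamel, gauss]
    rw [solution, hzero]

lemma continuous_hankel_gauss_mul_source (h : HankelData A G) (ha : -1 < a) (t x : ℝ) :
    Continuous fun s : ℝ =>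
      hankel a (fun ξ => gauss (Complex.I * ((t - s : ℝ) : ℂ)) ξ * G s ξ) x :=
  have hcont : Continuous fun q : ℝ × ℝ =>
      hankel a (fun ξ => gauss (Complex.I * ((t - q.1 : ℝ) : ℂ)) ξ * G q.1 ξ) q.2 :=
    (h.locallyRapidDecay_gauss_mul_source t).continuous_hankel ha fun ξ _ => by
      have := h.continuous_source
      unfold gauss
      fun_prop
  hcont.comp (f := fun s : ℝ => (s, x)) (by fun_prop)

end HankelData

variable {f : ℝ → ℂ} {F : ℝ → ℝ → ℂ}

lemma isSolution_solution (ha : -1 < a) (hf : SchwartzFamily fun _ : Unit => f)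
    (hF : LocallySchwartz fun t x => F x t) (hc : ∀ x, 0 < x → Continuous (F x)) :
    IsSolution a f F fun x t => solution a (hankel a f) (fun t => hankel a fun x => F x t) t x :=
  have h := (hankelData ha hf hF hc).isSolution ha
  { h with
    equation x hx t := (h.equation x hx t).trans ((hF.slice t).hankel_hankel ha () hx)
    initial x hx := (h.initial x hx).trans (hf.hankel_hankel ha () hx) }

lemma solution_hankel_eq (ha : -1 < a) (hf : SchwartzFamily fun _ : Unit => f)
    (hF : LocallySchwartz fun t x => F x t) (hc : ∀ x, 0 < x → Continuous (F x)) (t x : ℝ) :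
    solution a (hankel a f) (fun t => hankel a fun x => F x t) t x =
      freeEvolution a t f x + ∫ s in (0 : ℝ)..t, freeEvolution a (t - s) (fun y => F y s) x :=
  (hankelData ha hf hF hc).solution_eq ha t x

end Existence

/-! ### Uniqueness -/

section BoundaryTerms

variable {E E' : Type*} [NormedAddCommGroup E] [NormedAddCommGroup E']

lemma integral_Ioi_eq_zero_of_frequently_norm_le [NormedSpace ℝ E] [CompleteSpace E] {a : ℝ}
    {f f' : ℝ → E} (hderiv : ∀ x ∈ Ioi a, HasDerivAt f (f' x) x) (hint : IntegrableOn f' (Ioi a))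
    (hleft : ∀ c > 0, ∃ᶠ x in 𝓝[>] a, ‖f x‖ ≤ c) (hright : ∀ c > 0, ∃ᶠ x in atTop, ‖f x‖ ≤ c) :
    ∫ x in Ioi a, f' x = 0 := by
  have eq_zero {l : Filter ℝ} {m : E} (hlim : Tendsto f l (𝓝 m))
      (hfreq : ∀ c > 0, ∃ᶠ x in l, ‖f x‖ ≤ c) : m = 0 :=
    norm_le_zero_iff.1 (le_of_forall_gt_imp_ge_of_dense fun c hc =>
      le_of_tendsto_of_frequently hlim.norm (hfreq c hc))
  have htop : Tendsto f atTop (𝓝 0) := by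
    have hlim := tendsto_limUnder_of_hasDerivAt_of_integrableOn_Ioi hderiv hint
    rwa [eq_zero hlim hright] at hlim
  have hcover : AECover (volume.restrict (Ioi a)) (𝓝[>] a) Ioi :=
    aecover_Ioi_of_Ioi (tendsto_id.mono_left nhdsWithin_le_nhds)
  have hzero : Tendsto (fun x => -f x) (𝓝[>] a) (𝓝 (∫ x in Ioi a, f' x)) := by
    refine (hcover.integral_tendsto_of_countably_generated hint).congr'
      (eventually_mem_nhdsWithin.mono fun x hx => ?_)
    rw [Measure.restrict_restrict measurableSet_Ioi,
      inter_eq_self_of_subset_left (Ioi_subset_Ioi (le_of_lt hx)),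
      integral_Ioi_of_hasDerivAt_of_tendsto' (fun y hy => hderiv y (Ici_subset_Ioi.2 hx hy))
        (hint.mono_set (Ioi_subset_Ioi (le_of_lt hx))) htop, zero_sub]
  exact neg_eq_zero.1 (eq_zero (by simpa only [neg_neg] using hzero.neg) hleft)

variable {q q' : ℝ → E} {w : ℝ → E'} {c : ℝ}

lemma abs_log_sub_log_norm_sq_le [InnerProductSpace ℝ E] {s t : ℝ} (hst : s ≤ t) (hc : 0 < c)
    (hderiv : ∀ x ∈ Icc s t, HasDerivAt q (q' x) x)
    (hint : IntegrableOn (fun x => ‖q' x‖ * ‖w x‖) (Icc s t))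
    (hle : ∀ x ∈ Icc s t, c ≤ ‖q x‖ * ‖w x‖) :
    |Real.log (‖q t‖ ^ 2) - Real.log (‖q s‖ ^ 2)| ≤
      ∫ x in Icc s t, 2 / c * (‖q' x‖ * ‖w x‖) := by
  have hpos : ∀ x ∈ Icc s t, 0 < ‖q x‖ := fun x hx =>
    pos_of_mul_pos_left (hc.trans_le (hle x hx)) (norm_nonneg _)
  have hlog : ∀ x ∈ Icc s t, HasDerivAt (fun x => Real.log (‖q x‖ ^ 2))
      (2 * inner ℝ (q x) (q' x) / ‖q x‖ ^ 2) x := fun x hx =>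
    (hderiv x hx).norm_sq.log (pow_pos (hpos x hx) 2).ne'
  rw [← Real.norm_eq_abs, integral_Icc_eq_integral_Ioc, ← intervalIntegral.integral_of_le hst]
  refine norm_sub_le_integral_of_norm_deriv_le_of_le hst
    (fun x hx => (hlog x hx).continuousAt.continuousWithinAt)
    (fun x hx => (hlog x (Ioo_subset_Icc_self hx)).differentiableAt.differentiableWithinAt)
    (.of_forall fun x hx => ?_)
    ((intervalIntegrable_iff_integrableOn_Icc_of_le hst).2 (hint.const_mul (2 / c)))
  replace hx := Ioo_subset_Icc_self hx
  rw [(hlog x hx).deriv, norm_div, norm_mul, norm_pow, norm_norm, Real.norm_two,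
    div_mul_eq_mul_div, div_le_div_iff₀ (pow_pos (hpos x hx) 2) hc]
  calc 2 * ‖inner ℝ (q x) (q' x)‖ * c ≤ 2 * (‖q x‖ * ‖q' x‖) * (‖q x‖ * ‖w x‖) := by
        gcongr
        exacts [norm_inner_le_norm _ _, hle x hx]
    _ = 2 * (‖q' x‖ * ‖w x‖) * ‖q x‖ ^ 2 := by ring

/-- A Harnack inequality: `|(log ‖q‖)'| ≤ ‖q'‖ / ‖q‖ ≤ ‖q'‖ ‖w‖ / c` is integrable. -/
lemma exists_norm_le_mul_norm [InnerProductSpace ℝ E] {S : Set ℝ} (hS : S.OrdConnected)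
    (hc : 0 < c) (hderiv : ∀ x ∈ S, HasDerivAt q (q' x) x)
    (hint : IntegrableOn (fun x => ‖q' x‖ * ‖w x‖) S) (hle : ∀ x ∈ S, c ≤ ‖q x‖ * ‖w x‖) :
    ∃ K, ∀ s ∈ S, ∀ t ∈ S, ‖q t‖ ≤ K * ‖q s‖ := by
  have hpos : ∀ x ∈ S, 0 < ‖q x‖ := fun x hx =>
    pos_of_mul_pos_left (hc.trans_le (hle x hx)) (norm_nonneg _)
  set M := ∫ x in S, 2 / c * (‖q' x‖ * ‖w x‖)
  have hlog_le : ∀ s ∈ S, ∀ t ∈ S, s ≤ t →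
      |Real.log (‖q t‖ ^ 2) - Real.log (‖q s‖ ^ 2)| ≤ M := fun s hs t ht hst => by
    have hsub : Icc s t ⊆ S := hS.out hs ht
    exact (abs_log_sub_log_norm_sq_le hst hc (fun x hx => hderiv x (hsub hx))
      (hint.mono_set hsub) fun x hx => hle x (hsub hx)).trans
        (setIntegral_mono_set (hint.const_mul (2 / c)) (.of_forall fun x => by positivity)
          hsub.eventuallyLE)
  refine ⟨Real.exp (M / 2), fun s hs t ht => ?_⟩
  have hlog : Real.log (‖q t‖ ^ 2) - Real.log (‖q s‖ ^ 2) ≤ M :=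
    (le_total s t).elim (fun hst => (le_abs_self _).trans (hlog_le s hs t ht hst)) fun hts =>
      (le_abs_self _).trans ((abs_sub_comm _ _).trans_le (hlog_le t ht s hs hts))
  simp only [Real.log_pow, Nat.cast_ofNat] at hlog
  rw [← Real.log_le_log_iff (hpos t ht) (mul_pos (Real.exp_pos _) (hpos s hs)),
    Real.log_mul (Real.exp_pos _).ne' (hpos s hs).ne', Real.log_exp]
  linarith

lemma frequently_norm_mul_norm_le_nhdsGT [InnerProductSpace ℝ E] {a : ℝ}
    (hderiv : ∀ x ∈ Ioi a, HasDerivAt q (q' x) x)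
    (hint : IntegrableOn (fun x => ‖q' x‖ * ‖w x‖) (Ioi a)) (hlim : Tendsto q (𝓝[>] a) (𝓝 0))
    (hc : 0 < c) : ∃ᶠ x in 𝓝[>] a, ‖q x‖ * ‖w x‖ ≤ c := by
  by_contra hfreq
  obtain ⟨b, hab, hb⟩ := mem_nhdsGT_iff_exists_Ioo_subset.1 (not_frequently.1 hfreq)
  have hle : ∀ x ∈ Ioo a b, c ≤ ‖q x‖ * ‖w x‖ := fun x hx => (not_le.1 (hb hx)).le
  obtain ⟨K, hK⟩ := exists_norm_le_mul_norm ordConnected_Ioo hc (fun x hx => hderiv x hx.1)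
    (hint.mono_set Ioo_subset_Ioi_self) hle
  obtain ⟨t, ht⟩ := nonempty_Ioo.2 (mem_Ioi.1 hab)
  have hzero : ‖q t‖ ≤ K * ‖(0 : E)‖ := ge_of_tendsto (hlim.norm.const_mul K)
    (mem_of_superset (Ioo_mem_nhdsGT hab) fun s hs => hK s hs t ht)
  rw [norm_zero, mul_zero, norm_le_zero_iff] at hzero
  exact hc.not_ge (by simpa [hzero] using hle t ht)

lemma frequently_norm_mul_norm_le_atTop [InnerProductSpace ℝ E] {a b : ℝ} (ha : -1 ≤ a)
    (hderiv : ∀ x ∈ Ioi b, HasDerivAt q (q' x) x)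
    (hint : IntegrableOn (fun x => ‖q' x‖ * ‖w x‖) (Ioi b))
    (hw : IntegrableOn (fun x => x ^ a * ‖w x‖ ^ 2) (Ioi b)) (hc : 0 < c) :
    ∃ᶠ x in atTop, ‖q x‖ * ‖w x‖ ≤ c := by
  by_contra hfreq
  obtain ⟨R, hRb, hR⟩ := ((eventually_ge_atTop (max b 0)).and
    (eventually_forall_ge_atTop.2 (not_frequently.1 hfreq))).exists
  have hsub : Ioi R ⊆ Ioi b := Ioi_subset_Ioi ((le_max_left _ _).trans hRb)
  have hpos : ∀ x ∈ Ioi R, 0 < x := fun x hx => ((le_max_right _ _).trans hRb).trans_lt hx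
  have hle : ∀ x ∈ Ioi R, c ≤ ‖q x‖ * ‖w x‖ := fun x hx => (not_le.1 (hR x (le_of_lt hx))).le
  obtain ⟨K, hK⟩ := exists_norm_le_mul_norm ordConnected_Ioi hc (fun x hx => hderiv x (hsub hx))
    (hint.mono_set hsub) hle
  set k := K * ‖q (R + 1)‖
  have hk : ∀ x ∈ Ioi R, c ≤ k * ‖w x‖ := fun x hx => (hle x hx).trans
    (mul_le_mul_of_nonneg_right (hK _ (lt_add_one R) x hx) (norm_nonneg _))
  have hrpow : IntegrableOn (fun x : ℝ => x ^ a) (Ioi R) := by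
    refine ((hw.mono_set hsub).const_mul (k ^ 2 / c ^ 2)).mono'
      (by fun_prop : Measurable _).aestronglyMeasurable
      ((ae_restrict_mem measurableSet_Ioi).mono fun x hx => ?_)
    rw [Real.norm_of_nonneg (Real.rpow_nonneg (hpos x hx).le a), div_mul_eq_mul_div,
      le_div_iff₀ (by positivity)]
    calc x ^ a * c ^ 2 ≤ x ^ a * (k * ‖w x‖) ^ 2 := by
          have := Real.rpow_nonneg (hpos x hx).le a
          gcongr
          exact hk x hx
      _ = k ^ 2 * (x ^ a * ‖w x‖ ^ 2) := by ring
  have hlt := (integrableOn_Ioi_rpow_iff (hpos (R + 1) (lt_add_one R))).1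
    (hrpow.mono_set (Ioi_subset_Ioi (lt_add_one R).le))
  linarith

end BoundaryTerms

section Energy

variable {a : ℝ} {f g : ℝ → ℂ} {x : ℝ}

lemma hasDerivAt_of_contDiffOn_Ioi (hf : ContDiffOn ℝ 2 f (Ioi 0)) (hx : 0 < x) :
    HasDerivAt f (deriv f x) x :=
  (hf.differentiableOn two_ne_zero).hasDerivAt (Ioi_mem_nhds hx)

lemma hasDerivAt_deriv_of_contDiffOn_Ioi (hf : ContDiffOn ℝ 2 f (Ioi 0)) (hx : 0 < x) :
    HasDerivAt (deriv f) (deriv (deriv f) x) x :=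
  ((hf.deriv_of_isOpen (m := 1) isOpen_Ioi (by norm_num)).differentiableOn one_ne_zero).hasDerivAt
    (Ioi_mem_nhds hx)

lemma deriv_sub_of_contDiffOn_Ioi (hf : ContDiffOn ℝ 2 f (Ioi 0)) (hg : ContDiffOn ℝ 2 g (Ioi 0))
    (hx : 0 < x) : deriv (fun x => f x - g x) x = deriv f x - deriv g x :=
  ((hasDerivAt_of_contDiffOn_Ioi hf hx).sub (hasDerivAt_of_contDiffOn_Ioi hg hx)).deriv

lemma besselOp_sub (hf : ContDiffOn ℝ 2 f (Ioi 0)) (hg : ContDiffOn ℝ 2 g (Ioi 0)) (hx : 0 < x) :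
    besselOp a (fun x => f x - g x) x = besselOp a f x - besselOp a g x := by
  have hderiv : deriv (fun x => f x - g x) =ᶠ[𝓝 x] fun x => deriv f x - deriv g x := by
    filter_upwards [Ioi_mem_nhds hx] with y hy using deriv_sub_of_contDiffOn_Ioi hf hg hy
  have hderiv₂ : deriv (fun x => deriv f x - deriv g x) x = deriv (deriv f) x - deriv (deriv g) x :=
    ((hasDerivAt_deriv_of_contDiffOn_Ioi hf hx).sub
      (hasDerivAt_deriv_of_contDiffOn_Ioi hg hx)).deriv
  rw [besselOp, hderiv.deriv_eq, hderiv₂, hderiv.eq_of_nhds, besselOp, besselOp]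
  ring

lemma hasDerivAt_rpow_mul_deriv (a : ℝ) (hf : ContDiffOn ℝ 2 f (Ioi 0)) (hx : 0 < x) :
    HasDerivAt (fun x : ℝ => ((x ^ a : ℝ) : ℂ) * deriv f x) (((x ^ a : ℝ) : ℂ) * besselOp a f x)
      x := by
  refine ((Real.hasDerivAt_rpow_const (.inl hx.ne')).ofReal_comp.mul
    (hasDerivAt_deriv_of_contDiffOn_Ioi hf hx)).congr_deriv ?_
  rw [Real.rpow_sub_one hx.ne', besselOp]
  push_cast
  ring

/-- With `q = x ^ a f'`, the integrand against `dx` is the derivative of `Re (i q conj f)`, and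
`q' = x ^ a ℬ_a f`; so `‖q'‖ ‖f‖` is integrable and `q` tends to zero at the origin. -/
lemma integral_inner_I_mul_besselOp_eq_zero (ha : -1 < a) (hf : ContDiffOn ℝ 2 f (Ioi 0))
    (hfL : MemLp f 2 (omega a)) (hBL : MemLp (besselOp a f) 2 (omega a))
    (hneumann : Tendsto (fun x : ℝ => ((x ^ a : ℝ) : ℂ) * deriv f x) (𝓝[>] 0) (𝓝 0)) :
    ∫ x, inner ℝ (f x) (Complex.I * besselOp a f x) ∂(omega a) = 0 := by
  set q : ℝ → ℂ := fun x => ((x ^ a : ℝ) : ℂ) * deriv f x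
  set q' : ℝ → ℂ := fun x => ((x ^ a : ℝ) : ℂ) * besselOp a f x
  have hq : ∀ x ∈ Ioi 0, HasDerivAt q (q' x) x := fun x hx => hasDerivAt_rpow_mul_deriv a hf hx
  have hmul : IntegrableOn (fun x => ‖q' x‖ * ‖f x‖) (Ioi 0) :=
    (integrable_omega_iff.1 (hBL.norm.integrable_mul hfL.norm)).congr_fun
      (fun x hx => by
        simp [q', abs_of_nonneg (Real.rpow_nonneg (le_of_lt hx) a), mul_assoc]) measurableSet_Ioi
  have hsq : IntegrableOn (fun x => x ^ a * ‖f x‖ ^ 2) (Ioi 0) :=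
    integrable_omega_iff.1 ((memLp_two_iff_integrable_sq_norm hfL.1).1 hfL)
  have hint : Integrable (fun x => inner ℝ (f x) (Complex.I * besselOp a f x)) (omega a) :=
    (hBL.norm.integrable_mul hfL.norm).mono' (hfL.1.inner (hBL.1.const_mul Complex.I))
      (.of_forall fun x => (norm_inner_le_norm _ _).trans (by simp [mul_comm]))
  have hderiv : ∀ x ∈ Ioi 0, HasDerivAt (fun x => inner ℝ (f x) (Complex.I * q x))
      (x ^ a • inner ℝ (f x) (Complex.I * besselOp a f x)) x := fun x hx => by
    refine ((hasDerivAt_of_contDiffOn_Ioi hf hx).inner ℝ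
      ((hq x hx).const_mul Complex.I)).congr_deriv ?_
    simp [Complex.inner, q, q']
    ring
  have hle (x : ℝ) : ‖inner ℝ (f x) (Complex.I * q x)‖ ≤ ‖q x‖ * ‖f x‖ :=
    (norm_inner_le_norm _ _).trans (by simp [mul_comm])
  rw [integral_omega]
  exact integral_Ioi_eq_zero_of_frequently_norm_le hderiv (integrable_omega_iff.1 hint)
    (fun c hc => (frequently_norm_mul_norm_le_nhdsGT hq hmul hneumann hc).mono
      fun x hx => (hle x).trans hx)
    (fun c hc => (frequently_norm_mul_norm_le_atTop ha.le hq hmul hsq hc).mono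
      fun x hx => (hle x).trans hx)

end Energy

section Unique

lemma ae_eq_of_hasDerivAt_Lp {α E : Type*} [MeasurableSpace α] [NormedAddCommGroup E]
    [NormedSpace ℝ E] {μ : Measure α} {p : ENNReal} [Fact (1 ≤ p)] {U : ℝ → Lp E p μ}
    {U' : Lp E p μ} {u : ℝ → α → E} {u' : α → E} {t : ℝ} (hU : HasDerivAt U U' t)
    (hu : ∀ s, U s =ᵐ[μ] u s) (hd : ∀ᵐ x ∂μ, HasDerivAt (fun s => u s x) (u' x) t) :
    U' =ᵐ[μ] u' := by
  obtain ⟨s, hs⟩ := (𝓝[≠] t).exists_seq_tendsto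
  obtain ⟨r, hr, hlim⟩ := (tendstoInMeasure_of_tendsto_Lp
    ((hasDerivAt_iff_tendsto_slope.1 hU).comp hs)).exists_seq_tendsto_ae
  have hslope : ∀ᵐ x ∂μ, ∀ n, (slope U t (s n) : α → E) x = slope (fun s => u s x) t (s n) := by
    refine ae_all_iff.2 fun n => ?_
    simp only [slope_def_module]
    filter_upwards [Lp.coeFn_smul (s n - t)⁻¹ (U (s n) - U t), Lp.coeFn_sub (U (s n)) (U t),
      hu (s n), hu t] with x hsmul hsub hsn ht
    rw [hsmul, Pi.smul_apply, hsub, Pi.sub_apply, hsn, ht]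
  filter_upwards [hlim, hslope, hd] with x hlim hslope hd
  refine tendsto_nhds_unique hlim
    (((hasDerivAt_iff_tendsto_slope.1 hd).comp (hs.comp hr.tendsto_atTop)).congr fun n => ?_)
  exact (hslope (r n)).symm

lemma norm_eq_of_inner_deriv_eq_zero {H : Type*} [NormedAddCommGroup H] [InnerProductSpace ℝ H]
    {U : ℝ → H} (hU : Differentiable ℝ U) (hinner : ∀ t, inner ℝ (U t) (deriv U t) = 0)
    (s t : ℝ) : ‖U s‖ = ‖U t‖ := by
  have hsq : ‖U s‖ ^ 2 = ‖U t‖ ^ 2 :=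
    is_const_of_deriv_eq_zero (f := fun t => ‖U t‖ ^ 2) (hU.norm_sq ℝ)
      (fun t => by rw [(hU t).hasDerivAt.norm_sq.deriv, hinner, mul_zero]) s t
  exact (sq_eq_sq₀ (norm_nonneg _) (norm_nonneg _)).1 hsq

namespace IsSolution

variable {a : ℝ} {φ ψ : ℝ → ℂ} {F G u v : ℝ → ℝ → ℂ} {x : ℝ}

lemma sub (hu : IsSolution a φ F u) (hv : IsSolution a ψ G v) :
    IsSolution a (fun x => φ x - ψ x) (fun x t => F x t - G x t) fun x t => u x t - v x t where
  contDiff_space t := (hu.contDiff_space t).sub (hv.contDiff_space t)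
  differentiable_time x hx := (hu.differentiable_time x hx).sub (hv.differentiable_time x hx)
  contDiff_L2 := by
    obtain ⟨U, hU, hUu⟩ := hu.contDiff_L2
    obtain ⟨V, hV, hVv⟩ := hv.contDiff_L2
    exact ⟨fun t => U t - V t, hU.sub hV,
      fun t => (Lp.coeFn_sub (U t) (V t)).trans ((hUu t).sub (hVv t))⟩
  equation x hx t := by
    rw [← hu.equation x hx t, ← hv.equation x hx t,
      besselOp_sub (hu.contDiff_space t) (hv.contDiff_space t) hx,
      deriv_fun_sub (hu.differentiable_time x hx t) (hv.differentiable_time x hx t)]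
    ring
  neumann t := by
    have hlim := (hu.neumann t).sub (hv.neumann t)
    rw [sub_zero] at hlim
    refine hlim.congr' (eventually_mem_nhdsWithin.mono fun x hx => ?_)
    simp only [deriv_sub_of_contDiffOn_Ioi (hu.contDiff_space t) (hv.contDiff_space t) hx]
    ring
  initial x hx := by rw [hu.initial x hx, hv.initial x hx]

lemma hasDerivAt_time (h : IsSolution a φ (fun _ _ => 0) u) (t : ℝ) (hx : 0 < x) :
    HasDerivAt (u x) (Complex.I * besselOp a (fun z => u z t) x) t :=
  (h.differentiable_time x hx t).hasDerivAt.congr_deriv (sub_eq_zero.1 (h.equation x hx t))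

lemma exists_inner_deriv_Lp_eq_zero (ha : -1 < a) (h : IsSolution a φ (fun _ _ => 0) u) :
    ∃ U : ℝ → Lp ℂ 2 (omega a), Differentiable ℝ U ∧ (∀ t, inner ℝ (U t) (deriv U t) = 0) ∧
      ∀ t, U t =ᵐ[omega a] fun x => u x t := by
  obtain ⟨U, hU, hUu⟩ := h.contDiff_L2
  have hU' (t : ℝ) : ⇑(deriv U t) =ᵐ[omega a] fun x => Complex.I * besselOp a (fun z => u z t) x :=
    ae_eq_of_hasDerivAt_Lp (hU.differentiable one_ne_zero t).hasDerivAt hUu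
      (ae_omega_of_forall_pos a fun x hx => h.hasDerivAt_time t hx)
  have hbessel (t : ℝ) : MemLp (besselOp a fun z => u z t) 2 (omega a) := by
    refine ((Lp.memLp (deriv U t)).const_mul (-Complex.I)).ae_eq ?_
    filter_upwards [hU' t] with x hx
    rw [hx, ← mul_assoc]
    simp
  refine ⟨U, hU.differentiable one_ne_zero, fun t => ?_, hUu⟩
  rw [L2.inner_def, ← integral_inner_I_mul_besselOp_eq_zero ha (h.contDiff_space t)
    ((Lp.memLp (U t)).ae_eq (hUu t)) (hbessel t) (h.neumann t)]
  refine integral_congr_ae ?_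
  filter_upwards [hUu t, hU' t] with x hx hx'
  rw [hx, hx']

theorem unique (ha : -1 < a) (hu : IsSolution a φ F u) (hv : IsSolution a φ F v) (t : ℝ) :
    EqOn (fun x => u x t) (fun x => v x t) (Ioi 0) := by
  have h := hu.sub hv
  simp only [sub_self] at h
  obtain ⟨U, hU, hinner, hUw⟩ := h.exists_inner_deriv_Lp_eq_zero ha
  have hU0 : U 0 = 0 := by
    refine Lp.eq_zero_iff_ae_eq_zero.2 ((hUw 0).trans (ae_omega_of_forall_pos a fun x hx => ?_))
    exact h.initial x hx
  have hUt : U t = 0 := by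
    rw [← norm_eq_zero, norm_eq_of_inner_deriv_eq_zero hU hinner t 0, hU0, norm_zero]
  have hae : (fun x => u x t - v x t) =ᵐ[omega a] 0 :=
    (hUw t).symm.trans (Lp.eq_zero_iff_ae_eq_zero.1 hUt)
  have hae' : (fun x => u x t) =ᵐ[volume.restrict (Ioi 0)] fun x => v x t := by
    filter_upwards [(ae_withDensity_iff (by fun_prop)).1 hae, ae_restrict_mem measurableSet_Ioi]
      with x hx hpos
    exact sub_eq_zero.1 (hx (ENNReal.ofReal_pos.2 (Real.rpow_pos_of_pos hpos a)).ne')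
  exact Measure.eqOn_open_of_ae_eq hae' isOpen_Ioi (hu.contDiff_space t).continuousOn
    (hv.contDiff_space t).continuousOn

end IsSolution

end Unique

end HalfLine

end

theorem proposition1p1_general (a : ℝ) (ha : -1 < a) (φ : ℝ → ℂ) (hφ : HalfLine.IsSchwartzPlus φ)
    (F : ℝ → ℝ → ℂ) (hF : HalfLine.LocallySchwartz fun t x => F x t)
    (hF_cont : ∀ x, 0 < x → Continuous (F x)) :
    (∃ u : ℝ → ℝ → ℂ, HalfLine.IsSolution a φ F u) ∧
    ∀ u : ℝ → ℝ → ℂ, HalfLine.IsSolution a φ F u →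
      ∀ x : ℝ, 0 < x → ∀ t : ℝ, t ≠ 0 →
        Integrable (fun y => HalfLine.kernelS a x y t * φ y) (HalfLine.omega a) ∧
        (∀ s : ℝ, s ≠ t →
          Integrable (fun y => HalfLine.kernelS a x y (t - s) * F y s) (HalfLine.omega a)) ∧
        IntervalIntegrable
          (fun s => ∫ y, HalfLine.kernelS a x y (t - s) * F y s ∂(HalfLine.omega a))
          volume 0 t ∧
        u x t = (∫ y, HalfLine.kernelS a x y t * φ y ∂(HalfLine.omega a)) +
          ∫ s in (0 : ℝ)..t,
            ∫ y, HalfLine.kernelS a x y (t - s) * F y s ∂(HalfLine.omega a) := by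
  have hφS := hφ.schwartzFamily
  have hsol := HalfLine.isSolution_solution ha hφS hF hF_cont
  refine ⟨⟨_, hsol⟩, fun u hu x hx t ht => ?_⟩
  have hkernel : (fun s => HalfLine.freeEvolution a (t - s) (fun y => F y s) x) =ᵐ[volume]
      fun s => ∫ y, HalfLine.kernelS a x y (t - s) * F y s ∂(HalfLine.omega a) := by
    filter_upwards [volume.ae_ne t] with s hs
    exact (HalfLine.integral_kernelS_mul ha (hF.slice s) hx (sub_ne_zero.2 hs.symm)).symm
  have hcont : Continuous fun s => HalfLine.freeEvolution a (t - s) (fun y => F y s) x :=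
    (HalfLine.hankelData ha hφS hF hF_cont).continuous_hankel_gauss_mul_source ha t x
  refine ⟨HalfLine.integrable_kernelS_mul ha hφS hx ht, fun s hs =>
    HalfLine.integrable_kernelS_mul ha (hF.slice s) hx (sub_ne_zero.2 hs.symm),
    (hcont.intervalIntegrable 0 t).congr_ae (ae_restrict_of_ae hkernel), ?_⟩
  refine (hu.unique ha hsol t hx).trans ?_
  beta_reduce
  rw [HalfLine.solution_hankel_eq ha hφS hF hF_cont,
    HalfLine.integral_kernelS_mul ha hφS hx ht,
    intervalIntegral.integral_congr_ae (hkernel.mono fun s hs _ => hs)]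

theorem proposition1p1 (a : ℝ) (ha : -1 < a) (φ : ℝ → ℂ) (hφ : HalfLine.IsSchwartzPlus φ)
    (F : ℝ → ℝ → ℂ) (hF : HalfLine.IsSpaceTimeSchwartzPlus F) :
    (∃ u : ℝ → ℝ → ℂ, HalfLine.IsSolution a φ F u) ∧
    ∀ u : ℝ → ℝ → ℂ, HalfLine.IsSolution a φ F u →
      ∀ x : ℝ, 0 < x → ∀ t : ℝ, t ≠ 0 →
        Integrable (fun y => HalfLine.kernelS a x y t * φ y) (HalfLine.omega a) ∧
        (∀ s : ℝ, s ≠ t →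
          Integrable (fun y => HalfLine.kernelS a x y (t - s) * F y s) (HalfLine.omega a)) ∧
        IntervalIntegrable
          (fun s => ∫ y, HalfLine.kernelS a x y (t - s) * F y s ∂(HalfLine.omega a))
          volume 0 t ∧
        u x t = (∫ y, HalfLine.kernelS a x y t * φ y ∂(HalfLine.omega a)) +
          ∫ s in (0 : ℝ)..t,
            ∫ y, HalfLine.kernelS a x y (t - s) * F y s ∂(HalfLine.omega a) :=
  proposition1p1_general a ha φ hφ F hF.locallySchwartz fun _ hx => hF.continuous_time hx
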